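/- Let $K\ge 2$ and $q\ge 0$ be integers, let $P,D>0$, and let $\Omega\in\mathbb R$ satisfy $D\omega^2+\Omega>0$ with $\omega=\frac{2\pi}{P}\frac qK$. The $(K,q)$ ring is the family of filaments $$\xi_k(z)=r\,e^{i\omega z}e^{2\pi i k/K},\qquad k\in\mathbb Z/K,\qquad r>0,\quad r^2=\frac{K-1}{2(D\omega^2+\Omega)},$$ a steady state of the gradient flow $$\partial_t\xi_k=D\,\partial_z^2\xi_k-\Omega\,\xi_k+\sum_{j\neq k}\frac{\xi_k-\xi_j}{|\xi_k-\xi_j|^2},\qquad \xi_k(z+P)=\xi_{k+q}(z).$$ The ring is *energetically stable* if the linearization of this flow at the ring, acting on $C^2$ perturbations that satisfy the same boundary condition, has no eigenvalue with positive real part; otherwise it is *energetically unstable*. It is *unstable with respect to the mode* $(m,M)$ if there is an eigenvalue with positive real part whose eigenvector has the form $e^{2\pi ik/K}\big(e^{i(\omega+\alpha)z+2\pi i mk/K}c_++e^{i(\omega-\alpha)z-2\pi i mk/K}c_-\big)$, $c_\pm\in\mathbb C$, $\alpha=\frac{2\pi}{P}\big(\frac{mq}{K}+M\big)$ (the linearization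 is only real-linear; for eigenvalues of its complexification, the real and the imaginary part of the eigenvector both have this form). Put $$s=\Big(\frac{2\pi}{P}\Big)^2 2Dr^2,\qquad s_{(1,0)}=\frac{(K-1)K^2}{q^2},\qquad s_{(0,1)}=\frac{2(K-1)K^2}{4q^2-K^2}.$$ 1. If $q>0$, the ring is unstable with respect to the mode $(1,0)$ if and only if $s>s_{(1,0)}$, equivalently if and only if $\Omega<0$; and $s=s_{(1,0)}$ if and only if $\Omega=0$. In particular the ring is energetically unstable when $\Omega<0$. 2. Let $K\le 7$. If $q>0$, there is $s_{\max,e}>0$, depending only on $K$ and $q$, such that the ring is energetically stable if and only if $0<s\le s_{\max,e}$. If $q>K/2$, then $s_{\max,e}\le s_{(0,1)}$, and $s_{(0,1)}<s_{(1,0)}$ if and only if $q>K/\sqrt2$. (If $q=0$, the ring is energetically stable for every $s>0$.) For $q\le 6$ the following values of $s_{\max,e}$ hold with relative error at most $5\cdot10^{-4}$: $$\begin{array}{c|cccccc} & q=1&q=2&q=3&q=4&q=5&q=6\\\hline K=2&4&0.6667&0.25&0.1333&0.08333&0.05714\\ K=3&18&4.5&1.333&0.6545&0.3956&0.2667\\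 K=4&48&12&4.8&2&1.143&0.75\\ K=5&100&25&11.11&5.128&2.667&1.681\\ K=6&180&40.63&16.28&10.16&5.625&3.333\\ K=7&294&39.2&18.38&9.8&5.939&4.356 \end{array}$$ 3. Let $K>7$ and $q=1$. Then the ring is energetically stable if and only if $s_{(4,0)}\le s\le s_{(1,0)}$, where $s_{(4,0)}$ is the unique positive root of $$s^2+\tfrac16K^2(K-1)\,s-\tfrac1{24}K^4(K-4)(K-7)=0;$$ moreover, the ring is unstable with respect to the mode $(4,0)$ if and only if $s<s_{(4,0)}$. 4. Let $K>7$ and $q\ne1$ (with $q\ge 0$). Then the ring is energetically unstable for every $s>0$. -/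

import Mathlib

open Complex

namespace FilamentRing

noncomputable section

/-- The right-hand side of the overdamped (gradient) flow of `K` filaments
`ξ k : ℝ → ℂ`, `k` modulo `K`, in the frame rotating with angular velocity `Ω`:
`∂ₜ ξ_k = D ∂_z² ξ_k - Ω ξ_k + ∑_{j ≠ k} (ξ_k - ξ_j) / |ξ_k - ξ_j|²`. -/
def flowRHS {K : ℕ} [NeZero K] (D Ω : ℝ) (ξ : ZMod K → ℝ → ℂ) (k : ZMod K) (z : ℝ) : ℂ :=
  (D : ℂ) * iteratedDeriv 2 (ξ k) z - (Ω : ℂ) * ξ k z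
    + ∑ j ∈ Finset.univ.erase k, (ξ k z - ξ j z) / ((‖ξ k z - ξ j z‖ ^ 2 : ℝ) : ℂ)

/-- The doubly periodic boundary condition `ξ_k(z + P) = ξ_{k+q}(z)`, indices modulo `K`. -/
def TwistPeriodic {K : ℕ} (P : ℝ) (q : ℤ) (ξ : ZMod K → ℝ → ℂ) : Prop :=
  ∀ (k : ZMod K) (z : ℝ), ξ k (z + P) = ξ (k + (q : ZMod K)) z

/-- The wave number `ω = (2π/P) (q/K)` of the ring. -/
def waveNumber (K : ℕ) (q : ℤ) (P : ℝ) : ℝ := 2 * Real.pi / P * ((q : ℝ) / (K : ℝ))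

/-- The radius of the ring, `r² = (K - 1) / (2 (D ω² + Ω))`. -/
def radius (K : ℕ) (q : ℤ) (P D Ω : ℝ) : ℝ :=
  Real.sqrt (((K : ℝ) - 1) / (2 * (D * waveNumber K q P ^ 2 + Ω)))

/-- The parameters for which the `(K,q)` ring exists. -/
def Admissible (K : ℕ) (q : ℤ) (P D Ω : ℝ) : Prop :=
  0 < P ∧ 0 < D ∧ 0 < D * waveNumber K q P ^ 2 + Ω

/-- The `(K,q)` filament ring `ξ_k(z) = r e^{iωz} e^{2πik/K}`. -/
def ring {K : ℕ} (q : ℤ) (P D Ω : ℝ) (k : ZMod K) (z : ℝ) : ℂ :=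
  (radius K q P D Ω : ℂ) * exp (I * ((waveNumber K q P * z : ℝ) : ℂ))
    * exp (I * ((2 * Real.pi * (k.val : ℝ) / (K : ℝ) : ℝ) : ℂ))

/-- The dimensionless parameter `s = (2π/P)² 2 D r²`. -/
def sParam (K : ℕ) (q : ℤ) (P D Ω : ℝ) : ℝ :=
  (2 * Real.pi / P) ^ 2 * (2 * D * radius K q P D Ω ^ 2)

/-- `f` is the image of the perturbation `φ` under the linearization of the gradient flow at the
`(K,q)` ring: the directional derivative of the right-hand side at the ring along `φ`. -/
def IsLinearizedImage {K : ℕ} [NeZero K] (q : ℤ) (P D Ω : ℝ)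
    (φ f : ZMod K → ℝ → ℂ) : Prop :=
  ∀ (k : ZMod K) (z : ℝ),
    HasDerivAt
      (fun ε : ℝ => flowRHS D Ω (fun j y => ring q P D Ω j y + (ε : ℂ) * φ j y) k z)
      (f k z) 0

/-- `u, v` are the real and imaginary parts of an eigenvector, with eigenvalue `a + b√-1`, of (the
complexification of) the linearization `A` of the gradient flow at the `(K,q)` ring. As `A` is only
real-linear on complex-valued functions, this is written out as `A u = a u - b v`,
`A v = b u + a v`; equivalently, `e^{at} (cos(bt) u - sin(bt) v)` and
`e^{at} (sin(bt) u + cos(bt) v)` solve the linearized flow. -/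
structure IsEigenpair {K : ℕ} [NeZero K] (q : ℤ) (P D Ω a b : ℝ)
    (u v : ZMod K → ℝ → ℂ) : Prop where
  smooth_left : ∀ k, ContDiff ℝ 2 (u k)
  smooth_right : ∀ k, ContDiff ℝ 2 (v k)
  periodic_left : TwistPeriodic P q u
  periodic_right : TwistPeriodic P q v
  ne_zero : u ≠ 0 ∨ v ≠ 0
  eigen_left : IsLinearizedImage q P D Ω u (fun k z => (a : ℂ) * u k z - (b : ℂ) * v k z)
  eigen_right : IsLinearizedImage q P D Ω v (fun k z => (b : ℂ) * u k z + (a : ℂ) * v k z)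

/-- Energetic stability of the `(K,q)` ring: its linearization with respect to the gradient flow
has no eigenvalue with positive real part. -/
def EnergeticallyStable (K : ℕ) [NeZero K] (q : ℤ) (P D Ω : ℝ) : Prop :=
  ∀ (a b : ℝ) (u v : ZMod K → ℝ → ℂ), IsEigenpair q P D Ω a b u v → a ≤ 0

/-- The perturbations in the mode `(m, M)`: with `α = (2π/P) (mq/K + M)`,
`e^{2πik/K} (e^{i(α+ω)z} e^{2πimk/K} c₊ + e^{i(-α+ω)z} e^{-2πimk/K} c₋)`. -/
def modePerturbation {K : ℕ} (q : ℤ) (P : ℝ) (m M : ℤ) (cp cm : ℂ)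
    (k : ZMod K) (z : ℝ) : ℂ :=
  let α : ℝ := 2 * Real.pi / P * ((m : ℝ) * (q : ℝ) / (K : ℝ) + (M : ℝ))
  let ω : ℝ := waveNumber K q P
  let θ : ℝ := 2 * Real.pi * (k.val : ℝ) / (K : ℝ)
  exp (I * (θ : ℂ)) *
    (exp (I * (((α + ω) * z + (m : ℝ) * θ : ℝ) : ℂ)) * cp
      + exp (I * (((-α + ω) * z - (m : ℝ) * θ : ℝ) : ℂ)) * cm)

/-- Energetic instability with respect to the mode `(m, M)`: the linearization has an eigenvalue
with positive real part whose eigenvector is a perturbation in that mode. -/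
def UnstableMode (K : ℕ) [NeZero K] (q : ℤ) (P D Ω : ℝ) (m M : ℤ) : Prop :=
  ∃ (a b : ℝ) (cp cm dp dm : ℂ), 0 < a ∧
    IsEigenpair (K := K) q P D Ω a b
      (modePerturbation q P m M cp cm) (modePerturbation q P m M dp dm)

/-- `s_{(1,0)} = (K-1) K² / q²`. -/
def sOneZero (K : ℕ) (q : ℤ) : ℝ := ((K : ℝ) - 1) * (K : ℝ) ^ 2 / (q : ℝ) ^ 2

/-- `s_{(0,1)} = 2 (K-1) K² / (4q² - K²)`. -/
def sZeroOne (K : ℕ) (q : ℤ) : ℝ :=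
  2 * ((K : ℝ) - 1) * (K : ℝ) ^ 2 / (4 * (q : ℝ) ^ 2 - (K : ℝ) ^ 2)

/-- The quadratic polynomial whose positive root is `s_{(4,0)}`. -/
def quadFourZero (K : ℕ) (s : ℝ) : ℝ :=
  s ^ 2 + 1 / 6 * (K : ℝ) ^ 2 * ((K : ℝ) - 1) * s
    - 1 / 24 * (K : ℝ) ^ 4 * ((K : ℝ) - 4) * ((K : ℝ) - 7)

/-- Numerical values of the energetic stability threshold `s_max` to four significant digits; the
rows are `K = 2, …, 7` and the columns `q = 1, …, 6`. -/
def sMaxTable : Matrix (Fin 6) (Fin 6) ℝ :=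
  !![4, 0.6667, 0.25, 0.1333, 0.08333, 0.05714;
     18, 4.5, 1.333, 0.6545, 0.3956, 0.2667;
     48, 12, 4.8, 2, 1.143, 0.75;
     100, 25, 11.11, 5.128, 2.667, 1.681;
     180, 40.63, 16.28, 10.16, 5.625, 3.333;
     294, 39.2, 18.38, 9.8, 5.939, 4.356]

end

end FilamentRing

/-! The interaction is antiholomorphic, since `w / |w|² = 1 / conj w`, so its derivative along `φ`
is `-conj φ / (conj w)²`. In the frame of the ring this couples the wave with axial index `q + n`
and angular character `1 + m` only to the one with `q - n` and `1 - m`, where `n = mq + MK`. The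
coupling constant is a root-of-unity sum equal to `γ / (2r²)` with `γ = (m - 1)(K - 1 - m)` for `0 ≤
m < K`. On the amplitudes `(c₊, conj c₋)` the linearization is therefore a real symmetric 2×2
matrix.

The steady-state equation `2r²(Dω² + Ω) = K - 1` removes `Ω`. The trace of each matrix is negative,
so only the determinant matters. Up to a positive factor, with `t = s / K²`, it is `(K-1)² - γ² +
2(K-1) t n² + t² n² (n² - 4q²)`, which is `modeDet`. A negative determinant gives an explicit
unstable mode. Conversely, an arbitrary `C²` eigenvector has a nonzero Fourier coefficient, and the
corresponding pair of coefficients is an eigenvector of one of these matrices. Hence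
`energeticallyStable_iff`: the ring is stable iff every `modeDet` is nonnegative.

What remains is arithmetic in `t`. For `m = 1` the coupling vanishes and the determinant of mode
`(1,0)` factors, which gives the threshold `Ω = 0`. For `K ≤ 7` one has `γ² ≤ (K-1)²`, so
nonnegativity at `t` passes to all smaller `t ≥ 0` and there is a single threshold. Modes with `|n|
≥ 2q` never destabilize, so the table is a finite integer check. For `K > 7`, `m = 4` has `γ² >
(K-1)²`. With `q = 1`, mode `(4,0)` imposes the lower bound on `s`, mode `(1,0)` the upper one, and
all others follow from these two (`modeDet_nonneg_of_four`). With `q ≥ 2` there is always a mode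
with `γ` large and `n` small relative to `q`, for which the quadratic in `t` has no real root and is
negative everywhere (`exists_modeDet_neg`); for `q = 0` the constant term of mode `(4,0)` is already
negative. -/

namespace FilamentRing

open scoped ComplexConjugate

noncomputable section

/-! ### The character `k ↦ e^{2πik/K}` and the waves `z ↦ e^{2πinz/(PK)}` -/

/-- The character `k ↦ e^{2πik/K}` of `ℤ/K`. -/
def chi {K : ℕ} [NeZero K] (k : ZMod K) : ℂ := ZMod.stdAddChar k

section Char

variable {K : ℕ} [NeZero K]

lemma chi_zero : chi (0 : ZMod K) = 1 := AddChar.map_zero_eq_one _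

lemma chi_add (a b : ZMod K) : chi (a + b) = chi a * chi b := AddChar.map_add_eq_mul _ a b

lemma chi_mul_neg (a : ZMod K) : chi a * chi (-a) = 1 := by
  rw [← chi_add, add_neg_cancel, chi_zero]

lemma chi_ne_zero (a : ZMod K) : chi a ≠ 0 := left_ne_zero_of_mul_eq_one (chi_mul_neg a)

lemma chi_neg (a : ZMod K) : chi (-a) = (chi a)⁻¹ :=
  eq_inv_of_mul_eq_one_right (chi_mul_neg a)

lemma chi_sub (a b : ZMod K) : chi (a - b) = chi a / chi b := by
  rw [sub_eq_add_neg, chi_add, chi_neg, div_eq_mul_inv]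

lemma chi_injective : Function.Injective (chi : ZMod K → ℂ) := ZMod.injective_stdAddChar

lemma conj_chi (a : ZMod K) : conj (chi a) = chi (-a) := by
  rw [chi_neg]
  simp only [chi, ZMod.stdAddChar_apply]
  rw [← Circle.coe_inv_eq_conj, Circle.coe_inv]

lemma chi_intCast (j : ℤ) : chi (j : ZMod K) = exp (2 * Real.pi * I * j / K) :=
  ZMod.stdAddChar_coe j

lemma exp_angle (k : ZMod K) :
    exp (I * ((2 * Real.pi * (k.val : ℝ) / (K : ℝ) : ℝ) : ℂ)) = chi k := by
  have h := chi_intCast (K := K) (k.val : ℤ)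
  rw [Int.cast_natCast, ZMod.natCast_zmod_val] at h
  rw [h]
  congr 1
  push_cast
  ring

lemma exp_mul_angle (m : ℤ) (k : ZMod K) :
    exp (I * (m * (2 * Real.pi * (k.val : ℝ) / (K : ℝ) : ℝ) : ℝ)) = chi ((m : ZMod K) * k) := by
  have h := chi_intCast (K := K) (m * (k.val : ℤ))
  rw [Int.cast_mul, Int.cast_natCast, ZMod.natCast_zmod_val] at h
  rw [h]
  congr 1
  push_cast
  ring

lemma sum_chi_mul {p : ZMod K} (hp : p ≠ 0) : ∑ l : ZMod K, chi (p * l) = 0 := by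
  have h := AddChar.sum_mulShift (R' := ℂ) p (ZMod.isPrimitive_stdAddChar K)
  rw [if_neg hp, Nat.cast_zero] at h
  rw [← h]
  exact Finset.sum_congr rfl fun l _ => by rw [mul_comm]; rfl

end Char

/-- The wave `z ↦ e^{2πinz/(PK)}`. -/
def wave (K : ℕ) (P : ℝ) (n : ℤ) (z : ℝ) : ℂ := exp (I * ((waveNumber K n P * z : ℝ) : ℂ))

section Wave

variable {K : ℕ} {P : ℝ}

lemma waveNumber_add (a b : ℤ) : waveNumber K (a + b) P = waveNumber K a P + waveNumber K b P := by
  simp only [waveNumber]; push_cast; ring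

lemma waveNumber_neg (a : ℤ) : waveNumber K (-a) P = -waveNumber K a P := by
  simp only [waveNumber]; push_cast; ring

lemma wave_add (a b : ℤ) (z : ℝ) : wave K P (a + b) z = wave K P a z * wave K P b z := by
  rw [wave, wave, wave, ← exp_add, waveNumber_add]
  congr 1; push_cast; ring

lemma wave_zero_left (z : ℝ) : wave K P 0 z = 1 := by simp [wave, waveNumber]

lemma wave_zero_right (n : ℤ) : wave K P n 0 = 1 := by simp [wave]

lemma wave_ne_zero (n : ℤ) (z : ℝ) : wave K P n z ≠ 0 := exp_ne_zero _

lemma wave_neg (a : ℤ) (z : ℝ) : wave K P (-a) z = (wave K P a z)⁻¹ := by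
  refine eq_inv_of_mul_eq_one_left ?_
  rw [← wave_add, neg_add_cancel, wave_zero_left]

lemma conj_wave (n : ℤ) (z : ℝ) : conj (wave K P n z) = wave K P (-n) z := by
  rw [wave, wave, ← exp_conj, map_mul, conj_I, conj_ofReal, waveNumber_neg]
  congr 1; push_cast; ring

lemma wave_add_period [NeZero K] (hP : P ≠ 0) (n : ℤ) (z : ℝ) :
    wave K P n (z + P) = chi (n : ZMod K) * wave K P n z := by
  have hK : (K : ℂ) ≠ 0 := Nat.cast_ne_zero.mpr (NeZero.ne K)
  have hP' : (P : ℂ) ≠ 0 := ofReal_ne_zero.mpr hP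
  rw [chi_intCast, wave, wave, ← exp_add]
  congr 1
  simp only [waveNumber]
  push_cast
  field_simp
  ring

lemma hasDerivAt_wave (n : ℤ) (z : ℝ) :
    HasDerivAt (wave K P n) (I * (waveNumber K n P : ℂ) * wave K P n z) z := by
  have h1 : HasDerivAt (fun z : ℝ => ((waveNumber K n P * z : ℝ) : ℂ))
      ((waveNumber K n P : ℝ) : ℂ) z := by
    simpa using (((hasDerivAt_id z).const_mul (waveNumber K n P)).ofReal_comp)
  have h2 := (h1.const_mul I).cexp
  rw [mul_comm] at h2
  exact h2

lemma contDiff_wave (n : ℤ) {d : WithTop ℕ∞} : ContDiff ℝ d (wave K P n) := by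
  have : ContDiff ℝ d fun z : ℝ => ((waveNumber K n P * z : ℝ) : ℂ) :=
    ofRealCLM.contDiff.comp (contDiff_const.mul contDiff_id)
  exact (contDiff_const.mul this).cexp

lemma continuous_wave (n : ℤ) : Continuous (wave K P n) :=
  (contDiff_wave (d := 0) n).continuous

lemma iteratedDeriv_two_wave (n : ℤ) (z : ℝ) :
    iteratedDeriv 2 (wave K P n) z = -(waveNumber K n P : ℂ) ^ 2 * wave K P n z := by
  have h1 : deriv (wave K P n) = fun z => I * (waveNumber K n P : ℂ) * wave K P n z :=
    funext fun z => (hasDerivAt_wave n z).deriv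
  rw [iteratedDeriv_succ, iteratedDeriv_one, h1,
    ((hasDerivAt_wave n z).const_mul _).deriv]
  linear_combination (waveNumber K n P : ℂ) ^ 2 * wave K P n z * I_sq

lemma radius_pos {q : ℤ} {P D Ω : ℝ} (hK : 2 ≤ K) (h : Admissible K q P D Ω) :
    0 < radius K q P D Ω := by
  have hK : (2 : ℝ) ≤ K := by exact_mod_cast hK
  exact Real.sqrt_pos.mpr (div_pos (by linarith) (mul_pos two_pos h.2.2))

end Wave

/-! ### The linearization -/

section Linearization

variable {K : ℕ} [NeZero K]

lemma ring_eq (q : ℤ) (P D Ω : ℝ) (k : ZMod K) (z : ℝ) :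
    ring q P D Ω k z = (radius K q P D Ω : ℂ) * wave K P q z * chi k := by
  rw [ring, exp_angle]; rfl

lemma radius_sq {q : ℤ} {P D Ω : ℝ} (h : Admissible K q P D Ω) :
    2 * (D * waveNumber K q P ^ 2 + Ω) * radius K q P D Ω ^ 2 = (K : ℝ) - 1 := by
  have hK : (1 : ℝ) ≤ K := by exact_mod_cast NeZero.one_le
  have h2 := h.2.2
  rw [radius, Real.sq_sqrt (by have := sub_nonneg.mpr hK; positivity)]
  field_simp

lemma ring_sub_ne_zero {q : ℤ} {P D Ω : ℝ} (hK : 2 ≤ K) (h : Admissible K q P D Ω)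
    {k j : ZMod K} (hkj : j ≠ k) (z : ℝ) :
    ring q P D Ω k z - ring q P D Ω j z ≠ 0 := by
  rw [ring_eq, ring_eq, ← mul_sub]
  refine mul_ne_zero (mul_ne_zero (ofReal_ne_zero.mpr (radius_pos hK h).ne') (wave_ne_zero _ _)) ?_
  exact sub_ne_zero.mpr fun h => hkj (chi_injective h).symm

/-- The linearization of the gradient flow at the `(K,q)` ring. -/
def linearized (q : ℤ) (P D Ω : ℝ) (φ : ZMod K → ℝ → ℂ) (k : ZMod K) (z : ℝ) : ℂ :=
  (D : ℂ) * iteratedDeriv 2 (φ k) z - (Ω : ℂ) * φ k z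
    - ∑ j ∈ Finset.univ.erase k,
      conj (φ k z - φ j z) / conj (ring q P D Ω k z - ring q P D Ω j z) ^ 2

/-- Exhibits the interaction as antiholomorphic; at `w = 0` both sides take the default value `0`.
-/
lemma div_norm_sq (w : ℂ) : w / ((‖w‖ ^ 2 : ℝ) : ℂ) = (conj w)⁻¹ := by
  by_cases hw : w = 0
  · simp [hw]
  have : conj w ≠ 0 := (map_ne_zero _).mpr hw
  rw [← Complex.normSq_eq_norm_sq, ← Complex.mul_conj]
  field_simp

lemma contDiff_ring (q : ℤ) (P D Ω : ℝ) (k : ZMod K) {d : WithTop ℕ∞} :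
    ContDiff ℝ d (ring q P D Ω k) := by
  have : ring q P D Ω k = fun z => (radius K q P D Ω : ℂ) * wave K P q z * chi k :=
    funext fun z => ring_eq q P D Ω k z
  rw [this]
  exact (contDiff_const.mul (contDiff_wave q)).mul contDiff_const

lemma hasDerivAt_flowRHS {q : ℤ} {P D Ω : ℝ} (hK : 2 ≤ K) (h : Admissible K q P D Ω)
    {φ : ZMod K → ℝ → ℂ} (hφ : ∀ k, ContDiff ℝ 2 (φ k)) (k : ZMod K) (z : ℝ) :
    HasDerivAt
      (fun ε : ℝ => flowRHS D Ω (fun j y => ring q P D Ω j y + (ε : ℂ) * φ j y) k z)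
      (linearized q P D Ω φ k z) 0 := by
  have hlin (A B : ℂ) : HasDerivAt (fun ε : ℝ => A + (ε : ℂ) * B) B 0 := by
    simpa using ((ofRealCLM.hasDerivAt (x := (0 : ℝ))).mul_const B).const_add A
  have hiter (ε : ℝ) : iteratedDeriv 2 (fun y => ring q P D Ω k y + (ε : ℂ) * φ k y) z
      = iteratedDeriv 2 (ring q P D Ω k) z + (ε : ℂ) * iteratedDeriv 2 (φ k) z := by
    have h1 : ContDiffAt ℝ 2 (ring q P D Ω k) z := (contDiff_ring q P D Ω k).contDiffAt
    have h2 : ContDiffAt ℝ 2 (φ k) z := (hφ k).contDiffAt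
    rw [iteratedDeriv_fun_add h1 (contDiffAt_const.mul h2), iteratedDeriv_const_mul_field]
  have hterm (j : ZMod K) (hj : j ∈ Finset.univ.erase k) :
      HasDerivAt (fun ε : ℝ =>
        (ring q P D Ω k z + (ε : ℂ) * φ k z - (ring q P D Ω j z + (ε : ℂ) * φ j z)) /
          ((‖ring q P D Ω k z + (ε : ℂ) * φ k z -
            (ring q P D Ω j z + (ε : ℂ) * φ j z)‖ ^ 2 : ℝ) : ℂ))
        (-(conj (φ k z - φ j z) / conj (ring q P D Ω k z - ring q P D Ω j z) ^ 2)) 0 := by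
    have hne : conj (ring q P D Ω k z - ring q P D Ω j z) ≠ 0 :=
      (map_ne_zero _).mpr (ring_sub_ne_zero hK h (Finset.ne_of_mem_erase hj) z)
    -- Along the perturbation, `conj` of the separation is affine in the real parameter `ε`, so only
    -- the derivative of an inverse is needed.
    have h1 := (hlin (conj (ring q P D Ω k z - ring q P D Ω j z))
      (conj (φ k z - φ j z))).fun_inv (by simpa using hne)
    have h2 : (fun ε : ℝ => (conj (ring q P D Ω k z - ring q P D Ω j z)
        + (ε : ℂ) * conj (φ k z - φ j z))⁻¹) = fun ε : ℝ =>
        (ring q P D Ω k z + (ε : ℂ) * φ k z - (ring q P D Ω j z + (ε : ℂ) * φ j z)) /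
          ((‖ring q P D Ω k z + (ε : ℂ) * φ k z -
            (ring q P D Ω j z + (ε : ℂ) * φ j z)‖ ^ 2 : ℝ) : ℂ) := by
      funext ε
      rw [div_norm_sq]
      congr 1
      simp only [map_sub, map_add, map_mul, conj_ofReal]
      ring
    rw [h2] at h1
    refine h1.congr_deriv ?_
    rw [ofReal_zero, zero_mul, add_zero, neg_div]
  have hsum := HasDerivAt.fun_sum hterm
  have hmain := (((hlin (iteratedDeriv 2 (ring q P D Ω k) z)
    (iteratedDeriv 2 (φ k) z)).const_mul (D : ℂ)).sub
    ((hlin (ring q P D Ω k z) (φ k z)).const_mul (Ω : ℂ))).add hsum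
  refine (hmain.congr_deriv ?_).congr_of_eventuallyEq (Filter.Eventually.of_forall fun ε => ?_)
  · rw [linearized, Finset.sum_neg_distrib, ← sub_eq_add_neg]
  · simp only [flowRHS, hiter]
    rfl

lemma isLinearizedImage_iff {q : ℤ} {P D Ω : ℝ} (hK : 2 ≤ K) (h : Admissible K q P D Ω)
    {φ f : ZMod K → ℝ → ℂ} (hφ : ∀ k, ContDiff ℝ 2 (φ k)) :
    IsLinearizedImage q P D Ω φ f ↔ ∀ k z, linearized q P D Ω φ k z = f k z :=
  forall₂_congr fun k z => ⟨fun hf => (hasDerivAt_flowRHS hK h hφ k z).unique hf,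
    fun hf => hf ▸ hasDerivAt_flowRHS hK h hφ k z⟩

end Linearization

/-! ### The coupling sums -/

/-- Twice the coupling coefficient of the two waves of a mode, `(m - 1) (K - m - 1)` for
`0 ≤ m < K`. -/
def coupling (K : ℕ) (m : ℤ) : ℤ := (m % K - 1) * (K - 1 - m % K)

section Coupling

variable {K : ℕ} [NeZero K]

lemma coupling_neg (m : ℤ) : coupling K (-m) = coupling K m := by
  have hK : (0 : ℤ) < K := by exact_mod_cast NeZero.pos K
  have h1 := Int.emod_nonneg m hK.ne'
  have h2 := Int.emod_lt_of_pos m hK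
  by_cases h : m % K = 0
  · have : (-m) % K = 0 := Int.emod_eq_zero_of_dvd ((Int.dvd_of_emod_eq_zero h).neg_right)
    rw [coupling, coupling, h, this]
  · have : (-m) % K = K - m % K := by
      have h3 : -m = (K - m % K) + K * (-(m / K) - 1) := by
        have := Int.emod_add_mul_ediv m K
        linear_combination this
      rw [h3, Int.add_mul_emod_self_left]
      exact Int.emod_eq_of_lt (by omega) (by omega)
    rw [coupling, coupling, this]
    ring

/-- The sum `∑_{l ≠ 0} (1 - e^{2πipl/K}) / (1 - e^{2πil/K})²`. -/
def couplingSum (p : ZMod K) : ℂ :=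
  ∑ l ∈ (Finset.univ : Finset (ZMod K)).erase 0, (1 - chi (p * l)) / (1 - chi l) ^ 2

lemma one_sub_chi_ne_zero {l : ZMod K} (hl : l ≠ 0) : 1 - chi l ≠ 0 := by
  rw [← chi_zero (K := K)]
  exact sub_ne_zero.mpr fun h => hl (chi_injective h).symm

lemma card_erase_zero : (((Finset.univ : Finset (ZMod K)).erase 0).card : ℂ) = (K : ℂ) - 1 := by
  rw [Finset.card_erase_of_mem (Finset.mem_univ _), Finset.card_univ, ZMod.card,
    Nat.cast_sub (NeZero.one_le), Nat.cast_one]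

/-- The terms at `l` and `-l` pair up: `1/(1-ζ) + 1/(1-ζ⁻¹) = 1`. -/
lemma sum_inv_one_sub_chi :
    ∑ l ∈ (Finset.univ : Finset (ZMod K)).erase 0, (1 - chi l)⁻¹ = ((K : ℂ) - 1) / 2 := by
  have h1 : ∑ l ∈ (Finset.univ : Finset (ZMod K)).erase 0, (1 - chi l)⁻¹
      = ∑ l ∈ (Finset.univ : Finset (ZMod K)).erase 0, (1 - chi (-l))⁻¹ :=
    Finset.sum_nbij' (fun l => -l) (fun l => -l) (by simp) (by simp) (by simp) (by simp) (by simp)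
  have h2 : ∑ l ∈ (Finset.univ : Finset (ZMod K)).erase 0, ((1 - chi l)⁻¹ + (1 - chi (-l))⁻¹)
      = (K : ℂ) - 1 := by
    rw [← card_erase_zero, Finset.card_eq_sum_ones, Nat.cast_sum]
    refine Finset.sum_congr rfl fun l hl => ?_
    have h3 := one_sub_chi_ne_zero (Finset.ne_of_mem_erase hl)
    have h4 := one_sub_chi_ne_zero (neg_ne_zero.mpr (Finset.ne_of_mem_erase hl))
    have h5 := chi_mul_neg l
    field_simp
    push_cast
    linear_combination -h5
  rw [Finset.sum_add_distrib, ← h1] at h2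
  linear_combination h2 / 2

/-- Raising the frequency by one subtracts a full character sum without its `l = 0` term: that is `K
- 1` for frequency `0` and `-1` for the others. -/
lemma sum_chi_div_one_sub_chi (i : ℕ) (hi : i < K) :
    ∑ l ∈ (Finset.univ : Finset (ZMod K)).erase 0,
      chi (((i + 1 : ℕ) : ZMod K) * l) / (1 - chi l) = i - ((K : ℂ) - 1) / 2 := by
  have step (i : ℕ) : ∑ l ∈ (Finset.univ : Finset (ZMod K)).erase 0,
      chi (((i + 1 : ℕ) : ZMod K) * l) / (1 - chi l) =
      ∑ l ∈ (Finset.univ : Finset (ZMod K)).erase 0, chi ((i : ZMod K) * l) / (1 - chi l)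
      - ∑ l ∈ (Finset.univ : Finset (ZMod K)).erase 0, chi ((i : ZMod K) * l) := by
    rw [← Finset.sum_sub_distrib]
    refine Finset.sum_congr rfl fun l hl => ?_
    have h3 := one_sub_chi_ne_zero (Finset.ne_of_mem_erase hl)
    rw [Nat.cast_add, Nat.cast_one, add_mul, one_mul, chi_add]
    field_simp
    ring
  induction i with
  | zero =>
    rw [step]
    simp only [Nat.cast_zero, zero_mul, chi_zero, one_div, sum_inv_one_sub_chi, Finset.sum_const,
      nsmul_eq_mul, card_erase_zero, mul_one]
    ring
  | succ i ih =>
    have h1 : ((i + 1 : ℕ) : ZMod K) ≠ 0 := by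
      rw [Ne, ZMod.natCast_eq_zero_iff]
      exact fun h => absurd (Nat.le_of_dvd i.succ_pos h) (by omega)
    have h2 := sum_chi_mul h1
    rw [← Finset.add_sum_erase _ _ (Finset.mem_univ (0 : ZMod K)), mul_zero, chi_zero] at h2
    rw [step, ih (by omega)]
    push_cast at h2 ⊢
    linear_combination -h2

/-- Second summation: consecutive values of `couplingSum` differ by the sum of the preceding lemma,
which is linear in the frequency, so the result is quadratic. -/
lemma couplingSum_natCast (p : ℕ) (hp : p < K) :
    couplingSum ((p + 1 : ℕ) : ZMod K) = ((p : ℂ) - 1) * (p + 1 - K) / 2 := by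
  have step (p : ℕ) : couplingSum ((p + 1 : ℕ) : ZMod K) = couplingSum (p : ZMod K) +
      ∑ l ∈ (Finset.univ : Finset (ZMod K)).erase 0, chi ((p : ZMod K) * l) / (1 - chi l) := by
    rw [couplingSum, couplingSum, ← Finset.sum_add_distrib]
    refine Finset.sum_congr rfl fun l hl => ?_
    have h3 := one_sub_chi_ne_zero (Finset.ne_of_mem_erase hl)
    rw [Nat.cast_add, Nat.cast_one, add_mul, one_mul, chi_add]
    field_simp
    ring
  induction p with
  | zero =>
    rw [step]
    simp only [couplingSum, Nat.cast_zero, zero_mul, chi_zero, one_div, sum_inv_one_sub_chi,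
      sub_self, zero_div, Finset.sum_const_zero]
    ring
  | succ p ih =>
    rw [step, ih (by omega), sum_chi_div_one_sub_chi p (by omega)]
    push_cast
    ring

lemma couplingSum_one_add (m : ℤ) :
    couplingSum ((1 + m : ℤ) : ZMod K) = -(coupling K m : ℂ) / 2 := by
  have hK : (0 : ℤ) < K := by exact_mod_cast NeZero.pos K
  obtain ⟨p, hp⟩ := Int.eq_ofNat_of_zero_le (Int.emod_nonneg m hK.ne')
  have h2 := Int.emod_lt_of_pos m hK
  have h3 : ((1 + m : ℤ) : ZMod K) = ((p + 1 : ℕ) : ZMod K) := by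
    have h4 : 1 + m = ((p + 1 : ℕ) : ℤ) + K * (m / K) := by
      have := Int.emod_add_mul_ediv m K
      push_cast
      linear_combination -this + hp
    rw [h4]
    simp
  rw [h3, couplingSum_natCast p (by omega), coupling, hp]
  push_cast
  ring

end Coupling

/-! ### The action of the linearization on modes and on Fourier coefficients -/

section Action

variable {K : ℕ} [NeZero K]

/-- The eigenvalue of `D ∂_z² - Ω` on the wave with index `n`. -/
def waveEigenvalue (K : ℕ) (P D Ω : ℝ) (n : ℤ) : ℝ := -(D * waveNumber K n P ^ 2 + Ω)

lemma sum_erase_eq_sum_sub (f : ZMod K → ℂ) (k : ZMod K) :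
    ∑ j ∈ Finset.univ.erase k, f j = ∑ l ∈ Finset.univ.erase 0, f (k - l) :=
  Finset.sum_nbij' (fun j => k - j) (fun l => k - l)
    (by simp [sub_eq_zero, eq_comm]) (by simp) (by simp) (by simp) (by simp)

/-- With `j = k - l`, the conjugate separation is `r · wave⁻¹ · χ(k)⁻¹ · (1 - χ(l))`, so the kernel
is a convolution over `ℤ/K` up to the factor `χ(2k)` and the wave of index `2q`. -/
lemma sum_interaction (q : ℤ) (P D Ω : ℝ) (φ : ZMod K → ℝ → ℂ) (k : ZMod K) (z : ℝ) :
    ∑ j ∈ Finset.univ.erase k,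
        conj (φ k z - φ j z) / conj (ring q P D Ω k z - ring q P D Ω j z) ^ 2
      = wave K P (2 * q) z / (radius K q P D Ω : ℂ) ^ 2 *
        ∑ l ∈ Finset.univ.erase 0, chi (2 * k) * (conj (φ k z) - conj (φ (k - l) z))
          / (1 - chi l) ^ 2 := by
  rw [sum_erase_eq_sum_sub, Finset.mul_sum]
  refine Finset.sum_congr rfl fun l hl => ?_
  have h3 := one_sub_chi_ne_zero (Finset.ne_of_mem_erase hl)
  have hk := chi_ne_zero k
  have hw := wave_ne_zero (K := K) (P := P) q z
  have h4 : conj (ring q P D Ω k z - ring q P D Ω (k - l) z)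
      = (radius K q P D Ω : ℂ) * (wave K P q z)⁻¹ * (chi k)⁻¹ * (1 - chi l) := by
    have hl := chi_ne_zero l
    simp only [ring_eq, map_sub, map_mul, conj_ofReal, conj_wave, conj_chi, neg_sub]
    simp only [wave_neg, chi_neg, chi_sub]
    field_simp
  rw [h4, two_mul, two_mul, chi_add, wave_add, map_sub]
  by_cases hr : (radius K q P D Ω : ℂ) = 0
  · simp [hr]
  field_simp

/-- A single wave, with amplitude `c`. -/
def singleWave (K : ℕ) [NeZero K] (P : ℝ) (n a : ℤ) (c : ℂ) (k : ZMod K) (z : ℝ) : ℂ :=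
  wave K P n z * chi ((a : ZMod K) * k) * c

lemma contDiff_singleWave (P : ℝ) (n a : ℤ) (c : ℂ) (k : ZMod K) {d : WithTop ℕ∞} :
    ContDiff ℝ d (singleWave K P n a c k) :=
  ((contDiff_wave n).mul contDiff_const).mul contDiff_const

/-- Conjugation reverses both indices, and the factors of index `2q` and `2` shift them back to `2q
- n` and `1 - m`. -/
lemma linearized_singleWave (q : ℤ) (P D Ω : ℝ) (n m : ℤ) (c : ℂ) (k : ZMod K) (z : ℝ) :
    linearized q P D Ω (singleWave K P n (1 + m) c) k z
      = singleWave K P n (1 + m) (waveEigenvalue K P D Ω n * c) k z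
        + singleWave K P (2 * q - n) (1 - m)
          ((coupling K m : ℂ) / (2 * (radius K q P D Ω : ℂ) ^ 2) * conj c) k z := by
  have h1 : iteratedDeriv 2 (singleWave K P n (1 + m) c k) z
      = -(waveNumber K n P : ℂ) ^ 2 * singleWave K P n (1 + m) c k z := by
    have : singleWave K P n (1 + m) c k
        = fun z => (chi (((1 + m : ℤ) : ZMod K) * k) * c) * wave K P n z := by
      funext z; rw [singleWave]; ring
    rw [this, iteratedDeriv_const_mul_field, iteratedDeriv_two_wave]
    ring
  have h2 : ∑ l ∈ Finset.univ.erase 0, chi (2 * k) * (conj (singleWave K P n (1 + m) c k z)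
      - conj (singleWave K P n (1 + m) c (k - l) z)) / (1 - chi l) ^ 2
      = chi (((1 - m : ℤ) : ZMod K) * k) * wave K P (-n) z * conj c *
        couplingSum ((1 + m : ℤ) : ZMod K) := by
    rw [couplingSum, Finset.mul_sum]
    refine Finset.sum_congr rfl fun l _ => ?_
    have h3 : chi (((1 - m : ℤ) : ZMod K) * k) = chi (2 * k) * chi (-(((1 + m : ℤ) : ZMod K) * k)) := by
      rw [← chi_add]; congr 1; push_cast; ring
    have h4 : chi (-(((1 + m : ℤ) : ZMod K) * (k - l)))
        = chi (-(((1 + m : ℤ) : ZMod K) * k)) * chi (((1 + m : ℤ) : ZMod K) * l) := by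
      rw [← chi_add]; congr 1; ring
    simp only [singleWave, map_mul, conj_wave, conj_chi, h3, h4]
    ring
  have h5 : wave K P (2 * q - n) z = wave K P (2 * q) z * wave K P (-n) z := by
    rw [← wave_add, sub_eq_add_neg]
  rw [linearized, h1, sum_interaction, h2, couplingSum_one_add]
  simp only [singleWave, waveEigenvalue, h5]
  push_cast
  by_cases hr : (radius K q P D Ω : ℂ) = 0
  · simp [hr]; ring
  field_simp
  ring

lemma linearized_add (q : ℤ) (P D Ω : ℝ) {φ ψ : ZMod K → ℝ → ℂ} (hφ : ∀ k, ContDiff ℝ 2 (φ k))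
    (hψ : ∀ k, ContDiff ℝ 2 (ψ k)) (k : ZMod K) (z : ℝ) :
    linearized q P D Ω (fun k z => φ k z + ψ k z) k z
      = linearized q P D Ω φ k z + linearized q P D Ω ψ k z := by
  simp only [linearized]
  rw [iteratedDeriv_fun_add (hφ k).contDiffAt (hψ k).contDiffAt]
  have : ∑ j ∈ Finset.univ.erase k, conj (φ k z + ψ k z - (φ j z + ψ j z)) /
        conj (ring q P D Ω k z - ring q P D Ω j z) ^ 2
      = ∑ j ∈ Finset.univ.erase k, conj (φ k z - φ j z) /
        conj (ring q P D Ω k z - ring q P D Ω j z) ^ 2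
      + ∑ j ∈ Finset.univ.erase k, conj (ψ k z - ψ j z) /
        conj (ring q P D Ω k z - ring q P D Ω j z) ^ 2 := by
    rw [← Finset.sum_add_distrib]
    refine Finset.sum_congr rfl fun j _ => ?_
    rw [← add_div, ← map_add]
    congr 2
    ring
  rw [this]
  ring

/-- `α` is the wave number of the integer `mq + MK`; from here on all frequencies are integers. -/
lemma modePerturbation_eq (q : ℤ) (P : ℝ) (m M : ℤ) (cp cm : ℂ) :
    modePerturbation (K := K) q P m M cp cm
      = fun k z => singleWave K P (q + (m * q + M * K)) (1 + m) cp k z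
        + singleWave K P (q - (m * q + M * K)) (1 - m) cm k z := by
  have hK : (K : ℝ) ≠ 0 := Nat.cast_ne_zero.mpr (NeZero.ne K)
  have hα : 2 * Real.pi / P * ((m : ℝ) * (q : ℝ) / (K : ℝ) + (M : ℝ))
      = waveNumber K (m * q + M * K) P := by
    simp only [waveNumber]; push_cast; field_simp
  funext k z
  simp only [modePerturbation, hα, singleWave]
  have h1 : exp (I * (((waveNumber K (m * q + M * K) P + waveNumber K q P) * z
      + (m : ℝ) * (2 * Real.pi * (k.val : ℝ) / (K : ℝ)) : ℝ) : ℂ))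
      = wave K P (q + (m * q + M * K)) z * chi ((m : ZMod K) * k) := by
    rw [← exp_mul_angle, wave, ← exp_add, waveNumber_add q]
    congr 1; push_cast; ring
  have h2 : exp (I * (((-waveNumber K (m * q + M * K) P + waveNumber K q P) * z
      - (m : ℝ) * (2 * Real.pi * (k.val : ℝ) / (K : ℝ)) : ℝ) : ℂ))
      = wave K P (q - (m * q + M * K)) z * chi (-((m : ZMod K) * k)) := by
    rw [← neg_mul, ← Int.cast_neg, ← exp_mul_angle, wave, ← exp_add, sub_eq_add_neg q,
      waveNumber_add q, waveNumber_neg]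
    congr 1; push_cast; ring
  rw [h1, h2, exp_angle, Int.cast_add, Int.cast_sub, Int.cast_one, add_mul, sub_mul, one_mul,
    sub_eq_add_neg k, chi_add, chi_add]
  ring

lemma contDiff_modePerturbation (q : ℤ) (P : ℝ) (m M : ℤ) (cp cm : ℂ) (k : ZMod K)
    {d : WithTop ℕ∞} : ContDiff ℝ d (modePerturbation (K := K) q P m M cp cm k) := by
  rw [modePerturbation_eq]
  exact (contDiff_singleWave _ _ _ _ _).add (contDiff_singleWave _ _ _ _ _)

lemma linearized_modePerturbation (q : ℤ) (P D Ω : ℝ) (m M : ℤ) (cp cm : ℂ) (k : ZMod K) (z : ℝ) :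
    linearized q P D Ω (modePerturbation q P m M cp cm) k z
      = modePerturbation q P m M
        (waveEigenvalue K P D Ω (q + (m * q + M * K)) * cp
          + (coupling K m : ℂ) / (2 * (radius K q P D Ω : ℂ) ^ 2) * conj cm)
        (waveEigenvalue K P D Ω (q - (m * q + M * K)) * cm
          + (coupling K m : ℂ) / (2 * (radius K q P D Ω : ℂ) ^ 2) * conj cp) k z := by
  rw [modePerturbation_eq, modePerturbation_eq,
    linearized_add q P D Ω (fun k => contDiff_singleWave P _ _ _ k)
      (fun k => contDiff_singleWave P _ _ _ k),
    linearized_singleWave, show (1 - m : ℤ) = 1 + -m from rfl, linearized_singleWave, coupling_neg,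
    show (1 - -m : ℤ) = 1 + m by ring,
    show 2 * q - (q + (m * q + M * K)) = q - (m * q + M * K) by ring,
    show 2 * q - (q - (m * q + M * K)) = q + (m * q + M * K) by ring]
  simp only [singleWave]
  ring

lemma twistPeriodic_modePerturbation {P : ℝ} (hP : P ≠ 0) (q m M : ℤ) (cp cm : ℂ) :
    TwistPeriodic P q (modePerturbation (K := K) q P m M cp cm) := by
  intro k z
  have h1 : (((q + (m * q + M * K) : ℤ)) : ZMod K) = ((1 + m : ℤ) : ZMod K) * (q : ZMod K) := by
    push_cast [ZMod.natCast_self]; ring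
  have h2 : (((q - (m * q + M * K) : ℤ)) : ZMod K) = ((1 - m : ℤ) : ZMod K) * (q : ZMod K) := by
    push_cast [ZMod.natCast_self]; ring
  simp only [modePerturbation_eq, singleWave, wave_add_period hP, mul_add, chi_add, h1, h2]
  ring

end Action

/-! ### Fourier coefficients of twisted-periodic perturbations -/

section Fourier

variable {K : ℕ} [NeZero K]

/-- The discrete Fourier transform of a perturbation over the filament index. -/
def dual (φ : ZMod K → ℝ → ℂ) (a : ZMod K) (z : ℝ) : ℂ := ∑ k, chi (-(a * k)) * φ k z

/-- The Fourier coefficient of a perturbation on the wave `z ↦ e^{2πinz/(PK)} e^{2πiak/K}`. -/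
def coef (P : ℝ) (φ : ZMod K → ℝ → ℂ) (n a : ℤ) : ℂ :=
  ∫ z in (0 : ℝ)..P, wave K P (-n) z * dual φ a z

lemma continuous_dual {φ : ZMod K → ℝ → ℂ} (hφ : ∀ k, Continuous (φ k)) (a : ZMod K) :
    Continuous (dual φ a) :=
  continuous_finsetSum _ fun k _ => continuous_const.mul (hφ k)

lemma dual_add_period {P : ℝ} {q : ℤ} {φ : ZMod K → ℝ → ℂ} (hφ : TwistPeriodic P q φ)
    (a : ZMod K) (z : ℝ) : dual φ a (z + P) = chi (a * (q : ZMod K)) * dual φ a z := by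
  simp only [dual, hφ _ z, Finset.mul_sum]
  refine Fintype.sum_equiv (Equiv.addRight (q : ZMod K)) _ _ fun k => ?_
  rw [Equiv.coe_addRight, ← mul_assoc, ← chi_add]
  congr 2
  ring

lemma dual_injective {φ : ZMod K → ℝ → ℂ} {z : ℝ} (h : ∀ a, dual φ a z = 0) (k : ZMod K) :
    φ k z = 0 := by
  have h1 : ZMod.dft (fun k => φ k z) = 0 := by
    funext a
    rw [ZMod.dft_apply, Pi.zero_apply, ← h a]
    exact Finset.sum_congr rfl fun j _ => by rw [smul_eq_mul, mul_comm j a]; rfl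
  exact congrFun ((LinearEquiv.map_eq_zero_iff _).mp h1) k

lemma coef_linear (P : ℝ) {u v : ZMod K → ℝ → ℂ} (hu : ∀ k, Continuous (u k))
    (hv : ∀ k, Continuous (v k)) (a b : ℂ) (n m : ℤ) :
    coef P (fun k z => a * u k z + b * v k z) n m = a * coef P u n m + b * coef P v n m := by
  have h : (fun z => wave K P (-n) z * dual (fun k z => a * u k z + b * v k z) m z)
      = fun z => a * (wave K P (-n) z * dual u m z) + b * (wave K P (-n) z * dual v m z) := by
    funext z
    have : dual (fun k z => a * u k z + b * v k z) m z = a * dual u m z + b * dual v m z := by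
      simp only [dual, Finset.mul_sum, ← Finset.sum_add_distrib]
      exact Finset.sum_congr rfl fun k _ => by ring
    rw [this]
    ring
  have hi {w : ZMod K → ℝ → ℂ} (hw : ∀ k, Continuous (w k)) (c : ℂ) :
      IntervalIntegrable (fun z => c * (wave K P (-n) z * dual w m z)) MeasureTheory.volume 0 P :=
    (continuous_const.mul ((continuous_wave _).mul (continuous_dual hw _))).intervalIntegrable _ _
  rw [coef, h, intervalIntegral.integral_add (hi hu a) (hi hv b),
    intervalIntegral.integral_const_mul, intervalIntegral.integral_const_mul]
  rfl

/-- Integration by parts. The condition `n ≡ aq` mod `K` makes the integrand `P`-periodic, so the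
boundary terms cancel. -/
lemma coef_deriv {P : ℝ} (hP : P ≠ 0) {q : ℤ} {φ : ZMod K → ℝ → ℂ} (hφ : ∀ k, ContDiff ℝ 1 (φ k))
    (hper : TwistPeriodic P q φ) {n a : ℤ} (hn : (n : ZMod K) = (a : ZMod K) * q) :
    coef P (fun k => deriv (φ k)) n a = I * (waveNumber K n P : ℂ) * coef P φ n a := by
  have hc (k : ZMod K) : Continuous (deriv (φ k)) := (hφ k).continuous_deriv le_rfl
  have hderiv (z : ℝ) : HasDerivAt (fun z => wave K P (-n) z * dual φ a z)
      (-(I * (waveNumber K n P : ℂ)) * (wave K P (-n) z * dual φ a z)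
        + wave K P (-n) z * dual (fun k => deriv (φ k)) a z) z := by
    have h1 : HasDerivAt (dual φ a) (dual (fun k => deriv (φ k)) a z) z :=
      HasDerivAt.fun_sum fun k _ =>
        (((hφ k).differentiable one_ne_zero).differentiableAt.hasDerivAt).const_mul _
    refine ((hasDerivAt_wave (-n) z).mul h1).congr_deriv ?_
    rw [waveNumber_neg]
    push_cast
    ring
  have hi1 : IntervalIntegrable (fun z => -(I * (waveNumber K n P : ℂ)) *
      (wave K P (-n) z * dual φ a z)) MeasureTheory.volume 0 P :=
    (continuous_const.mul ((continuous_wave _).mul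
      (continuous_dual (fun k => (hφ k).continuous) _))).intervalIntegrable _ _
  have hi2 : IntervalIntegrable (fun z => wave K P (-n) z * dual (fun k => deriv (φ k)) a z)
      MeasureTheory.volume 0 P :=
    ((continuous_wave _).mul (continuous_dual hc _)).intervalIntegrable _ _
  have h2 := intervalIntegral.integral_eq_sub_of_hasDerivAt (fun z _ => hderiv z) (hi1.add hi2)
  have h3 : wave K P (-n) P * dual φ a P = wave K P (-n) 0 * dual φ a 0 := by
    have h4 := wave_add_period hP (K := K) (-n) 0
    have h5 := dual_add_period hper a 0
    rw [zero_add] at h4 h5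
    have h6 := chi_mul_neg ((a : ZMod K) * (q : ZMod K))
    rw [h4, h5, Int.cast_neg, hn]
    linear_combination (wave K P (-n) 0 * dual φ a 0) * h6
  rw [h3, sub_self, intervalIntegral.integral_add hi1 hi2,
    intervalIntegral.integral_const_mul] at h2
  rw [coef, coef]
  linear_combination h2

lemma TwistPeriodic.deriv {K : ℕ} {P : ℝ} {q : ℤ} {φ : ZMod K → ℝ → ℂ} (h : TwistPeriodic P q φ) :
    TwistPeriodic P q (fun k => deriv (φ k)) := by
  intro k z
  show _root_.deriv (φ k) (z + P) = _root_.deriv (φ (k + q)) z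
  rw [← show (fun z => φ k (z + P)) = φ (k + q) from funext (h k)]
  exact (deriv_comp_add_const (φ k) P z).symm

lemma coef_iteratedDeriv {P : ℝ} (hP : P ≠ 0) {q : ℤ} {φ : ZMod K → ℝ → ℂ}
    (hφ : ∀ k, ContDiff ℝ 2 (φ k)) (hper : TwistPeriodic P q φ) {n a : ℤ}
    (hn : (n : ZMod K) = (a : ZMod K) * q) :
    coef P (fun k => iteratedDeriv 2 (φ k)) n a = -(waveNumber K n P : ℂ) ^ 2 * coef P φ n a := by
  have h1 : (fun k => iteratedDeriv 2 (φ k)) = fun k => deriv (deriv (φ k)) := by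
    funext k; rw [iteratedDeriv_succ, iteratedDeriv_one]
  have h2 (k : ZMod K) : ContDiff ℝ 1 (deriv (φ k)) :=
    ((contDiff_succ_iff_deriv (n := 1)).mp (by simpa [one_add_one_eq_two] using hφ k)).2.2
  rw [h1, coef_deriv hP h2 hper.deriv hn,
    coef_deriv hP (fun k => (hφ k).of_le (by norm_num)) hper hn]
  linear_combination (waveNumber K n P : ℂ) ^ 2 * coef P φ n a * I_sq

lemma dual_linearized (q : ℤ) (P D Ω : ℝ) (φ : ZMod K → ℝ → ℂ) (m : ℤ) (z : ℝ) :
    dual (linearized q P D Ω φ) ((1 + m : ℤ) : ZMod K) z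
      = D * dual (fun k => iteratedDeriv 2 (φ k)) ((1 + m : ℤ) : ZMod K) z
        - Ω * dual φ ((1 + m : ℤ) : ZMod K) z
        + (coupling K m : ℂ) / (2 * (radius K q P D Ω : ℂ) ^ 2)
          * (wave K P (2 * q) z * conj (dual φ ((1 - m : ℤ) : ZMod K) z)) := by
  have h1 (k : ZMod K) : chi (-(((1 + m : ℤ) : ZMod K) * k)) * chi (2 * k)
      = chi (((1 - m : ℤ) : ZMod K) * k) := by
    rw [← chi_add]; congr 1; push_cast; ring
  have h2 (l : ZMod K) : ∑ k, chi (((1 - m : ℤ) : ZMod K) * k) * conj (φ (k - l) z)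
      = chi (((1 - m : ℤ) : ZMod K) * l) * conj (dual φ ((1 - m : ℤ) : ZMod K) z) := by
    rw [dual, map_sum, Finset.mul_sum]
    refine Fintype.sum_equiv (Equiv.subRight l) _ _ fun k => ?_
    rw [Equiv.subRight_apply, map_mul, conj_chi, ← mul_assoc, ← chi_add]
    congr 2
    ring
  have h3 : ∑ k, chi (((1 - m : ℤ) : ZMod K) * k) * conj (φ k z)
      = conj (dual φ ((1 - m : ℤ) : ZMod K) z) := by
    simpa [chi_zero] using h2 0
  have h4 : ∑ k, chi (-(((1 + m : ℤ) : ZMod K) * k)) *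
      ∑ l ∈ Finset.univ.erase 0, chi (2 * k) * (conj (φ k z) - conj (φ (k - l) z))
          / (1 - chi l) ^ 2
      = couplingSum ((1 - m : ℤ) : ZMod K) * conj (dual φ ((1 - m : ℤ) : ZMod K) z) := by
    simp only [Finset.mul_sum]
    rw [Finset.sum_comm, couplingSum, Finset.sum_mul]
    refine Finset.sum_congr rfl fun l _ => ?_
    rw [div_mul_eq_mul_div, sub_mul, one_mul, ← h2 l, ← h3, ← Finset.sum_sub_distrib,
      Finset.sum_div]
    refine Finset.sum_congr rfl fun k _ => ?_
    rw [← h1 k]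
    ring
  rw [show (1 - m : ℤ) = 1 + -m from rfl, couplingSum_one_add, coupling_neg] at h4
  have h5 : dual (linearized q P D Ω φ) ((1 + m : ℤ) : ZMod K) z
      = D * dual (fun k => iteratedDeriv 2 (φ k)) ((1 + m : ℤ) : ZMod K) z
        - Ω * dual φ ((1 + m : ℤ) : ZMod K) z
        - wave K P (2 * q) z / (radius K q P D Ω : ℂ) ^ 2 *
          ∑ k, chi (-(((1 + m : ℤ) : ZMod K) * k)) *
            ∑ l ∈ Finset.univ.erase 0, chi (2 * k) * (conj (φ k z) - conj (φ (k - l) z))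
              / (1 - chi l) ^ 2 := by
    simp only [dual, linearized, sum_interaction]
    rw [Finset.mul_sum, Finset.mul_sum, Finset.mul_sum, ← Finset.sum_sub_distrib,
      ← Finset.sum_sub_distrib]
    exact Finset.sum_congr rfl fun k _ => by ring
  rw [h5, h4, show (1 - m : ℤ) = 1 + -m from rfl]
  by_cases hr : (radius K q P D Ω : ℂ) = 0
  · simp [hr]
  field_simp
  ring

/-- The 2×2 action seen on Fourier coefficients: it applies to any `C²` perturbation, without
expanding it in a series. -/
lemma coef_linearized {q : ℤ} {P D Ω : ℝ} (hP : P ≠ 0) {φ : ZMod K → ℝ → ℂ}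
    (hφ : ∀ k, ContDiff ℝ 2 (φ k)) (hper : TwistPeriodic P q φ) (m M : ℤ) :
    coef P (linearized q P D Ω φ) (q + (m * q + M * K)) (1 + m)
      = waveEigenvalue K P D Ω (q + (m * q + M * K)) * coef P φ (q + (m * q + M * K)) (1 + m)
        + (coupling K m : ℂ) / (2 * (radius K q P D Ω : ℂ) ^ 2)
          * conj (coef P φ (q - (m * q + M * K)) (1 - m)) := by
  have hn : ((q + (m * q + M * K) : ℤ) : ZMod K) = ((1 + m : ℤ) : ZMod K) * (q : ZMod K) := by
    push_cast [ZMod.natCast_self]; ring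
  have hn' : q - (m * q + M * K) = 2 * q - (q + (m * q + M * K)) := by ring
  have h2 := coef_iteratedDeriv hP hφ hper hn
  rw [hn']
  generalize q + (m * q + M * K) = n at *
  have hc (k : ZMod K) : Continuous (φ k) := (hφ k).continuous
  have hc2 (k : ZMod K) : Continuous (iteratedDeriv 2 (φ k)) :=
    (hφ k).continuous_iteratedDeriv 2 le_rfl
  have hcw := continuous_wave (K := K) (P := P) (-n)
  have h3 : (fun z => wave K P (-n) z * dual (linearized q P D Ω φ) ((1 + m : ℤ) : ZMod K) z)
      = fun z => ((D : ℂ) * (wave K P (-n) z *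
            dual (fun k => iteratedDeriv 2 (φ k)) ((1 + m : ℤ) : ZMod K) z)
          - Ω * (wave K P (-n) z * dual φ ((1 + m : ℤ) : ZMod K) z))
        + (coupling K m : ℂ) / (2 * (radius K q P D Ω : ℂ) ^ 2)
          * conj (wave K P (-(2 * q - n)) z * dual φ ((1 - m : ℤ) : ZMod K) z) := by
    funext z
    rw [dual_linearized, map_mul, conj_wave, neg_neg, sub_eq_add_neg (2 * q), wave_add]
    ring
  have i1 : IntervalIntegrable (fun z => (D : ℂ) * (wave K P (-n) z *
      dual (fun k => iteratedDeriv 2 (φ k)) ((1 + m : ℤ) : ZMod K) z)) MeasureTheory.volume 0 P :=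
    (continuous_const.mul (hcw.mul (continuous_dual hc2 _))).intervalIntegrable _ _
  have i2 : IntervalIntegrable (fun z => (Ω : ℂ) * (wave K P (-n) z *
      dual φ ((1 + m : ℤ) : ZMod K) z)) MeasureTheory.volume 0 P :=
    (continuous_const.mul (hcw.mul (continuous_dual hc _))).intervalIntegrable _ _
  have i3 : IntervalIntegrable (fun z => (coupling K m : ℂ) / (2 * (radius K q P D Ω : ℂ) ^ 2)
      * conj (wave K P (-(2 * q - n)) z * dual φ ((1 - m : ℤ) : ZMod K) z))
      MeasureTheory.volume 0 P :=
    (continuous_const.mul (continuous_conj.comp ((continuous_wave _).mul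
      (continuous_dual hc _)))).intervalIntegrable _ _
  have h4 : ∫ z in (0 : ℝ)..P, conj (wave K P (-(2 * q - n)) z * dual φ ((1 - m : ℤ) : ZMod K) z)
      = conj (coef P φ (2 * q - n) (1 - m)) := by
    rw [coef]
    simp only [intervalIntegral, map_sub, ← integral_conj]
  rw [coef, h3, intervalIntegral.integral_add (i1.sub i2) i3, intervalIntegral.integral_sub i1 i2,
    intervalIntegral.integral_const_mul, intervalIntegral.integral_const_mul,
    intervalIntegral.integral_const_mul, h4]
  simp only [coef] at h2 ⊢
  rw [h2]
  simp only [waveEigenvalue]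
  push_cast
  ring

/-- Vanishing coefficients are summable, so the Fourier series of a continuous function converges
pointwise to it, and its sum is `0`. -/
lemma eq_zero_of_fourier_eq_zero {P : ℝ} (hP : 0 < P) {g : ℝ → ℂ} (hg : Continuous g)
    (hper : Function.Periodic g P)
    (h : ∀ M : ℤ, ∫ z in (0 : ℝ)..P, exp (2 * Real.pi * I * (-M : ℤ) * z / P) * g z = 0) (z : ℝ) :
    g z = 0 := by
  have : Fact (0 < P) := ⟨hP⟩
  let G : C(AddCircle P, ℂ) := ⟨hper.lift, continuous_coinduced_dom.mpr hg⟩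
  have hG (x : ℝ) : G (x : AddCircle P) = g x := rfl
  have hcoef (M : ℤ) : fourierCoeff (G : AddCircle P → ℂ) M = 0 := by
    rw [fourierCoeff_eq_intervalIntegral _ _ 0, zero_add]
    simp only [fourier_coe_apply, smul_eq_mul, hG, h M, smul_zero]
  have hsum := has_pointwise_sum_fourier_series_of_summable (f := G)
    (by rw [funext hcoef]; exact summable_zero) (z : AddCircle P)
  simp only [hcoef, zero_smul] at hsum
  exact hsum.unique hasSum_zero

/-- Over one period `dual φ a` gains the factor `χ(aq)`; multiplying by the wave of index `-aq`
leaves a `P`-periodic function whose coefficients are the given ones. -/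
lemma eq_zero_of_coef_eq_zero {P : ℝ} (hP : 0 < P) {q : ℤ} {φ : ZMod K → ℝ → ℂ}
    (hφ : ∀ k, Continuous (φ k)) (hper : TwistPeriodic P q φ)
    (h : ∀ m M : ℤ, coef P φ (q + (m * q + M * K)) (1 + m) = 0) : φ = 0 := by
  have hK : (K : ℂ) ≠ 0 := Nat.cast_ne_zero.mpr (NeZero.ne K)
  have hdual (z : ℝ) (a : ZMod K) : dual φ a z = 0 := by
    obtain ⟨a, rfl⟩ := ZMod.intCast_surjective a
    have h1 : wave K P (-(a * q)) z * dual φ a z = 0 := by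
      refine eq_zero_of_fourier_eq_zero hP (g := fun z => wave K P (-(a * q)) z * dual φ a z)
        ((continuous_wave _).mul (continuous_dual hφ _)) (fun z => ?_) (fun M => ?_) z
      · have := chi_mul_neg ((a : ZMod K) * (q : ZMod K))
        simp only [wave_add_period hP.ne', dual_add_period hper]
        push_cast
        linear_combination (wave K P (-(a * q)) z * dual φ a z) * this
      -- The mode `m = a - 1` has character `1 + m = a` and axial index `aq + MK`.
      · rw [← h (a - 1) M, coef]
        refine intervalIntegral.integral_congr fun z _ => ?_
        have h2 : exp (2 * Real.pi * I * (-M : ℤ) * z / P) = wave K P (-(M * K)) z := by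
          rw [wave]
          congr 1
          simp only [waveNumber]
          push_cast
          field_simp
        rw [h2, ← mul_assoc, ← wave_add]
        ring_nf
    exact (mul_eq_zero.mp h1).resolve_left (wave_ne_zero _ _)
  funext k z
  exact dual_injective (hdual z) k

end Fourier

/-! ### The stability criterion -/

lemma quadratic_form_nonpos {l₁ l₂ c : ℝ} (hsum : l₁ + l₂ ≤ 0) (hdet : c ^ 2 ≤ l₁ * l₂)
    (x y : ℝ) : l₁ * x ^ 2 + 2 * c * (x * y) + l₂ * y ^ 2 ≤ 0 := by
  have h1 : l₁ ≤ 0 := by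
    by_contra! h
    nlinarith [sq_nonneg c]
  have h2 : l₂ ≤ 0 := by
    by_contra! h
    nlinarith [sq_nonneg c]
  rcases h1.eq_or_lt with h | h
  · have : c = 0 := by
      rw [h, zero_mul] at hdet
      exact pow_eq_zero_iff two_ne_zero |>.mp (le_antisymm hdet (sq_nonneg c))
    rw [h, this]
    nlinarith [sq_nonneg y]
  · by_contra! h3
    nlinarith [sq_nonneg (l₁ * x + c * y), mul_nonneg (sub_nonneg.mpr hdet) (sq_nonneg y)]

/-- A real symmetric matrix with eigenvalues `≤ 0` has no eigenvalue with positive real part. -/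
lemma eigenvalue_nonpos {l₁ l₂ c a b : ℝ} (hsum : l₁ + l₂ ≤ 0) (hdet : c ^ 2 ≤ l₁ * l₂)
    {x y x' y' : ℂ} (h1 : l₁ * x + c * y = a * x - b * x') (h2 : l₂ * y + c * x = a * y - b * y')
    (h3 : l₁ * x' + c * y' = b * x + a * x') (h4 : l₂ * y' + c * x' = b * y + a * y')
    (hne : ¬(x = 0 ∧ y = 0 ∧ x' = 0 ∧ y' = 0)) : a ≤ 0 := by
  have r1 := congrArg re h1
  have i1 := congrArg im h1
  have r2 := congrArg re h2
  have i2 := congrArg im h2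
  have r3 := congrArg re h3
  have i3 := congrArg im h3
  have r4 := congrArg re h4
  have i4 := congrArg im h4
  simp only [add_re, add_im, sub_re, sub_im, re_ofReal_mul, im_ofReal_mul] at r1 i1 r2 i2 r3 i3 r4 i4
  have q1 := quadratic_form_nonpos hsum hdet x.re y.re
  have q2 := quadratic_form_nonpos hsum hdet x.im y.im
  have q3 := quadratic_form_nonpos hsum hdet x'.re y'.re
  have q4 := quadratic_form_nonpos hsum hdet x'.im y'.im
  by_contra! ha
  have hN : x.re ^ 2 + x.im ^ 2 + y.re ^ 2 + y.im ^ 2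
      + x'.re ^ 2 + x'.im ^ 2 + y'.re ^ 2 + y'.im ^ 2 ≤ 0 := by
    -- Pairing the equations with their own vectors cancels the `b` terms and leaves `a` times the
    -- squared norm equal to a sum of four values of the quadratic form.
    have : a * (x.re ^ 2 + x.im ^ 2 + y.re ^ 2 + y.im ^ 2
      + x'.re ^ 2 + x'.im ^ 2 + y'.re ^ 2 + y'.im ^ 2) ≤ 0 := by
      linear_combination q1 + q2 + q3 + q4 - x.re * r1 - x.im * i1 - y.re * r2 - y.im * i2
        - x'.re * r3 - x'.im * i3 - y'.re * r4 - y'.im * i4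
    exact nonpos_of_mul_nonpos_right this ha
  have hz (w : ℂ) (h : w.re ^ 2 + w.im ^ 2 ≤ 0) : w = 0 := by
    apply Complex.ext
    · rw [zero_re]; nlinarith [sq_nonneg w.re, sq_nonneg w.im]
    · rw [zero_im]; nlinarith [sq_nonneg w.re, sq_nonneg w.im]
  have p1 := sq_nonneg x.re
  have p2 := sq_nonneg x.im
  have p3 := sq_nonneg y.re
  have p4 := sq_nonneg y.im
  have p5 := sq_nonneg x'.re
  have p6 := sq_nonneg x'.im
  have p7 := sq_nonneg y'.re
  have p8 := sq_nonneg y'.im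
  exact hne ⟨hz x (by linarith), hz y (by linarith), hz x' (by linarith), hz y' (by linarith)⟩

/-- A real symmetric matrix with negative determinant and nonnegative off-diagonal entry has a
nonnegative eigenvector for a positive eigenvalue. -/
lemma exists_nonneg_eigenvector {l₁ l₂ c : ℝ} (hc : 0 ≤ c) (hdet : l₁ * l₂ < c ^ 2) :
    ∃ a x y : ℝ, 0 < a ∧ 0 < x + y ∧ l₁ * x + c * y = a * x ∧ l₂ * y + c * x = a * y := by
  rcases hc.eq_or_lt with h | h
  · subst h
    have h1 : l₁ * l₂ < 0 := by simpa using hdet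
    rcases lt_or_ge 0 l₁ with h2 | h2
    · exact ⟨l₁, 1, 0, h2, by simp, by ring, by ring⟩
    · have : 0 < l₂ := by by_contra! h3; nlinarith
      exact ⟨l₂, 0, 1, this, by simp, by ring, by ring⟩
  · set d := Real.sqrt ((l₁ - l₂) ^ 2 + 4 * c ^ 2) with hd
    have hd2 : d ^ 2 = (l₁ - l₂) ^ 2 + 4 * c ^ 2 := Real.sq_sqrt (by positivity)
    have hdpos : 0 < d := Real.sqrt_pos.mpr (by positivity)
    have h1 : |l₁ - l₂| < d := by
      refine abs_lt_of_sq_lt_sq ?_ hdpos.le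
      rw [hd2]; nlinarith
    have h2 : -(l₁ + l₂) < d := by
      refine lt_of_le_of_lt (neg_le_abs _) (abs_lt_of_sq_lt_sq ?_ hdpos.le)
      rw [hd2]; nlinarith
    refine ⟨(l₁ + l₂ + d) / 2, c, (l₂ - l₁ + d) / 2, by linarith, ?_, by ring, ?_⟩
    · have := (abs_lt.mp h1).2; linarith
    · linear_combination -hd2 / 4

/-- The determinant of the linearization on a mode with winding number `m` and axial index `n`,
times `(2r²)²`, as a function of `t = s / K²`. -/
def modeDet (K : ℕ) (q : ℤ) (t : ℝ) (m n : ℤ) : ℝ :=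
  ((K : ℝ) - 1 + t * ((n : ℝ) ^ 2 + 2 * q * n)) * ((K : ℝ) - 1 + t * ((n : ℝ) ^ 2 - 2 * q * n))
    - (coupling K m : ℝ) ^ 2

section Criterion

variable {K : ℕ} {q : ℤ} {P D Ω : ℝ}

lemma sParam_pos (hK : 2 ≤ K) (h : Admissible K q P D Ω) : 0 < sParam K q P D Ω := by
  have h1 := radius_pos hK h
  have h2 := h.1
  have h3 := h.2.1
  have := Real.pi_pos
  rw [sParam]
  positivity

variable [NeZero K]

/-- By the steady-state relation `radius_sq`, only `(q + n)² - q²` remains and `Ω` disappears. -/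
lemma waveEigenvalue_eq (h : Admissible K q P D Ω) (n : ℤ) :
    2 * radius K q P D Ω ^ 2 * waveEigenvalue K P D Ω (q + n)
      = -((K : ℝ) - 1 + sParam K q P D Ω / (K : ℝ) ^ 2 * ((n : ℝ) ^ 2 + 2 * q * n)) := by
  have hK : (K : ℝ) ≠ 0 := Nat.cast_ne_zero.mpr (NeZero.ne K)
  have hP := h.1.ne'
  rw [← radius_sq h, waveEigenvalue, sParam]
  simp only [waveNumber]
  push_cast
  field_simp
  ring

lemma mode_trace_nonpos (hK : 2 ≤ K) (h : Admissible K q P D Ω) (n : ℤ) :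
    waveEigenvalue K P D Ω (q + n) + waveEigenvalue K P D Ω (q - n) ≤ 0 := by
  have hr := radius_pos hK h
  have h1 := waveEigenvalue_eq h n
  have h2 := waveEigenvalue_eq h (-n)
  have hK' : (2 : ℝ) ≤ K := by exact_mod_cast hK
  have hs : 0 ≤ sParam K q P D Ω / (K : ℝ) ^ 2 * (n : ℝ) ^ 2 := by
    have := sParam_pos hK h
    positivity
  rw [← sub_eq_add_neg] at h2
  push_cast at h2
  refine nonpos_of_mul_nonpos_right (a := 2 * radius K q P D Ω ^ 2) ?_ (by positivity)
  rw [mul_add, h1, h2]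
  linarith

lemma modeDet_eq (hK : 2 ≤ K) (h : Admissible K q P D Ω) (m n : ℤ) :
    modeDet K q (sParam K q P D Ω / (K : ℝ) ^ 2) m n = (2 * radius K q P D Ω ^ 2) ^ 2 *
      (waveEigenvalue K P D Ω (q + n) * waveEigenvalue K P D Ω (q - n)
        - ((coupling K m : ℝ) / (2 * radius K q P D Ω ^ 2)) ^ 2) := by
  have hr := (radius_pos hK h).ne'
  have h1 := waveEigenvalue_eq h n
  have h2 := waveEigenvalue_eq h (-n)
  rw [← sub_eq_add_neg] at h2
  push_cast at h2
  have h3 : (2 * radius K q P D Ω ^ 2) ^ 2 *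
      (waveEigenvalue K P D Ω (q + n) * waveEigenvalue K P D Ω (q - n)
        - ((coupling K m : ℝ) / (2 * radius K q P D Ω ^ 2)) ^ 2)
      = (2 * radius K q P D Ω ^ 2 * waveEigenvalue K P D Ω (q + n)) *
        (2 * radius K q P D Ω ^ 2 * waveEigenvalue K P D Ω (q - n)) - (coupling K m : ℝ) ^ 2 := by
    field_simp
  rw [h3, h1, h2, modeDet]
  ring

lemma energeticallyStable_of_modeDet_nonneg (hK : 2 ≤ K) (h : Admissible K q P D Ω)
    (hdet : ∀ m M : ℤ, 0 ≤ modeDet K q (sParam K q P D Ω / (K : ℝ) ^ 2) m (m * q + M * K)) :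
    EnergeticallyStable K q P D Ω := by
  intro a b u v huv
  have hP := h.1
  have hex : ∃ m M : ℤ, ¬(coef P u (q + (m * q + M * K)) (1 + m) = 0 ∧
      coef P v (q + (m * q + M * K)) (1 + m) = 0) := by
    by_contra! hall
    rcases huv.ne_zero with hu | hv
    · exact hu (eq_zero_of_coef_eq_zero hP (fun k => (huv.smooth_left k).continuous)
        huv.periodic_left fun m M => (hall m M).1)
    · exact hv (eq_zero_of_coef_eq_zero hP (fun k => (huv.smooth_right k).continuous)
        huv.periodic_right fun m M => (hall m M).2)
  obtain ⟨m, M, hmM⟩ := hex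
  have hu := (isLinearizedImage_iff hK h huv.smooth_left).mp huv.eigen_left
  have hv := (isLinearizedImage_iff hK h huv.smooth_right).mp huv.eigen_right
  have hcu (k : ZMod K) : Continuous (u k) := (huv.smooth_left k).continuous
  have hcv (k : ZMod K) : Continuous (v k) := (huv.smooth_right k).continuous
  have eu (n m : ℤ) : coef P (linearized q P D Ω u) n m = a * coef P u n m - b * coef P v n m := by
    have : linearized q P D Ω u = fun k z => (a : ℂ) * u k z + (-b : ℂ) * v k z := by
      funext k z; rw [hu]; ring
    rw [this, coef_linear P hcu hcv]
    ring
  have ev (n m : ℤ) : coef P (linearized q P D Ω v) n m = b * coef P u n m + a * coef P v n m := by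
    have : linearized q P D Ω v = fun k z => (b : ℂ) * u k z + (a : ℂ) * v k z := by
      funext k z; rw [hv]
    rw [this, coef_linear P hcu hcv]
  have e1 := coef_linearized hP.ne' (D := D) (Ω := Ω) huv.smooth_left huv.periodic_left m M
  -- The mode `(-m, -M)` exchanges the two waves; after conjugation it supplies the second row of
  -- the symmetric matrix.
  have e2 := coef_linearized hP.ne' (D := D) (Ω := Ω) huv.smooth_left huv.periodic_left (-m) (-M)
  have e3 := coef_linearized hP.ne' (D := D) (Ω := Ω) huv.smooth_right huv.periodic_right m M
  have e4 := coef_linearized hP.ne' (D := D) (Ω := Ω) huv.smooth_right huv.periodic_right (-m) (-M)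
  rw [eu] at e1 e2
  rw [ev] at e3 e4
  have hneg : -m * q + -M * K = -(m * q + M * K) := by ring
  rw [hneg, coupling_neg, sub_neg_eq_add, sub_neg_eq_add, ← sub_eq_add_neg, ← sub_eq_add_neg]
    at e2 e4
  have hd := hdet m M
  rw [modeDet_eq hK h] at hd
  have hr := radius_pos hK h
  have hd' := nonneg_of_mul_nonneg_right hd (by positivity)
  have c2 := congrArg conj e2
  have c4 := congrArg conj e4
  simp only [map_add, map_sub, map_mul, conj_conj, conj_ofReal, map_div₀, map_pow, map_intCast,
    map_ofNat] at c2 c4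
  refine eigenvalue_nonpos (mode_trace_nonpos hK h (m * q + M * K)) (sub_nonneg.mp hd')
    (b := b) (x := coef P u (q + (m * q + M * K)) (1 + m))
    (y := conj (coef P u (q - (m * q + M * K)) (1 - m)))
    (x' := coef P v (q + (m * q + M * K)) (1 + m))
    (y' := conj (coef P v (q - (m * q + M * K)) (1 - m))) ?_ ?_ ?_ ?_
    (fun hz => hmM ⟨hz.1, hz.2.2.1⟩)
  · push_cast; exact e1.symm
  · push_cast; exact c2.symm
  · push_cast; exact e3.symm
  · push_cast; exact c4.symm

lemma unstableMode_of_modeDet_neg (hK : 2 ≤ K) (h : Admissible K q P D Ω) (m M : ℤ)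
    (hdet : modeDet K q (sParam K q P D Ω / (K : ℝ) ^ 2) m (m * q + M * K) < 0) :
    UnstableMode K q P D Ω m M := by
  have hr := radius_pos hK h
  rw [modeDet_eq hK h] at hdet
  have hd := neg_of_mul_neg_right hdet (by positivity)
  set l₁ := waveEigenvalue K P D Ω (q + (m * q + M * K)) with hl₁
  set l₂ := waveEigenvalue K P D Ω (q - (m * q + M * K)) with hl₂
  set c := (coupling K m : ℝ) / (2 * radius K q P D Ω ^ 2) with hc
  have hcc : (coupling K m : ℂ) / (2 * (radius K q P D Ω : ℂ) ^ 2) = (c : ℂ) := by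
    rw [hc]; push_cast; rfl
  have hsq : l₁ * l₂ < |c| ^ 2 := by rw [sq_abs]; linarith
  obtain ⟨a, x, y, ha, hxy, h1, h2⟩ := exists_nonneg_eigenvector (abs_nonneg c) hsq
  have hex : ∃ ε : ℂ, ε ≠ 0 ∧ (c : ℂ) * conj ε = (|c| : ℝ) * ε := by
    -- The phase `1` or `I` absorbs the sign of `c`. Working with `|c|` keeps `x, y ≥ 0` with `x + y
    -- > 0`, so the mode is nonzero at `k = 0`, `z = 0` even if its two waves coincide.
    rcases le_total 0 c with hc0 | hc0
    · exact ⟨1, one_ne_zero, by rw [abs_of_nonneg hc0, map_one]⟩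
    · exact ⟨I, I_ne_zero, by rw [abs_of_nonpos hc0, conj_I]; push_cast; ring⟩
  obtain ⟨ε, hε, hcε⟩ := hex
  have hsm (k : ZMod K) := contDiff_modePerturbation q P m M (ε * x) (ε * y) k (d := 2)
  have hsm0 (k : ZMod K) := contDiff_modePerturbation q P m M 0 0 k (d := 2)
  have hzero (k : ZMod K) (z : ℝ) : modePerturbation q P m M 0 0 k z = 0 := by
    simp [modePerturbation]
  have h1' := congrArg (fun r : ℝ => (r : ℂ)) h1
  have h2' := congrArg (fun r : ℝ => (r : ℂ)) h2
  push_cast at h1' h2'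
  refine ⟨a, 0, ε * x, ε * y, 0, 0, ha, ⟨hsm, hsm0, twistPeriodic_modePerturbation h.1.ne' _ _ _ _ _,
    twistPeriodic_modePerturbation h.1.ne' _ _ _ _ _, Or.inl fun h0 => ?_,
    (isLinearizedImage_iff hK h hsm).mpr fun k z => ?_,
    (isLinearizedImage_iff hK h hsm0).mpr fun k z => ?_⟩⟩
  · have h3 := congrFun (congrFun h0 0) 0
    rw [modePerturbation_eq] at h3
    simp only [singleWave, wave_zero_right, mul_zero, chi_zero, one_mul, Pi.zero_apply] at h3
    rw [← mul_add] at h3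
    have h4 := (mul_eq_zero.mp h3).resolve_left hε
    exact hxy.ne' (by exact_mod_cast h4)
  · rw [linearized_modePerturbation, hcc, ← hl₁, ← hl₂, map_mul, map_mul, conj_ofReal, conj_ofReal,
      modePerturbation_eq, modePerturbation_eq]
    have e1 : (l₁ : ℂ) * (ε * x) + c * (conj ε * y) = a * (ε * x) := by
      linear_combination ε * h1' + y * hcε
    have e2 : (l₂ : ℂ) * (ε * y) + c * (conj ε * x) = a * (ε * y) := by
      linear_combination ε * h2' + x * hcε
    rw [e1, e2]
    simp only [singleWave]
    push_cast
    ring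
  · rw [linearized_modePerturbation, map_zero, mul_zero, mul_zero, mul_zero, add_zero]
    simp [hzero]

lemma not_energeticallyStable_of_unstableMode {m M : ℤ} (h : UnstableMode K q P D Ω m M) :
    ¬EnergeticallyStable K q P D Ω := by
  obtain ⟨a, b, cp, cm, dp, dm, ha, hpair⟩ := h
  exact fun hst => ha.not_ge (hst _ _ _ _ hpair)

lemma not_energeticallyStable_of_modeDet_neg (hK : 2 ≤ K) (h : Admissible K q P D Ω) (m M : ℤ)
    (hdet : modeDet K q (sParam K q P D Ω / (K : ℝ) ^ 2) m (m * q + M * K) < 0) :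
    ¬EnergeticallyStable K q P D Ω :=
  not_energeticallyStable_of_unstableMode (unstableMode_of_modeDet_neg hK h m M hdet)

theorem energeticallyStable_iff (hK : 2 ≤ K) (h : Admissible K q P D Ω) :
    EnergeticallyStable K q P D Ω ↔
      ∀ m M : ℤ, 0 ≤ modeDet K q (sParam K q P D Ω / (K : ℝ) ^ 2) m (m * q + M * K) := by
  refine ⟨fun hst m M => ?_, energeticallyStable_of_modeDet_nonneg hK h⟩
  by_contra! hneg
  exact not_energeticallyStable_of_modeDet_neg hK h m M hneg hst

lemma wave_linearIndependent (hP : P ≠ 0) {n : ℤ} (hn : n ≠ 0) {X Y : ℂ}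
    (h : ∀ z, wave K P (q + n) z * X + wave K P (q - n) z * Y = 0) : X = 0 ∧ Y = 0 := by
  have hK : (K : ℂ) ≠ 0 := Nat.cast_ne_zero.mpr (NeZero.ne K)
  have hn' : (n : ℂ) ≠ 0 := Int.cast_ne_zero.mpr hn
  have hP' : (P : ℂ) ≠ 0 := ofReal_ne_zero.mpr hP
  have h0 := h 0
  rw [wave_zero_right, wave_zero_right] at h0
  -- A quarter period of the wave of index `n`, where it equals `I`; together with `z = 0` this
  -- separates `X` and `Y`.
  have h1 := h (P * K / (4 * n))
  have hw : wave K P n (P * K / (4 * n)) = I := by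
    rw [wave]
    convert exp_pi_div_two_mul_I using 2
    simp only [waveNumber]
    push_cast
    field_simp
    norm_num
  rw [sub_eq_add_neg, wave_add, wave_add, wave_neg, hw, inv_I] at h1
  have h2 : X - Y = 0 := by
    have h3 : wave K P q (P * K / (4 * n)) * I * (X - Y) = 0 := by linear_combination h1
    exact (mul_eq_zero.mp h3).resolve_left (mul_ne_zero (wave_ne_zero _ _) I_ne_zero)
  constructor
  · linear_combination (h0 + h2) / 2
  · linear_combination (h0 - h2) / 2

/-- For `n ≠ 0` the two waves are already independent on the filament `k = 0`, so amplitudes can be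
compared; this is where `hn` enters. -/
theorem unstableMode_iff (hK : 2 ≤ K) (h : Admissible K q P D Ω) (m M : ℤ)
    (hn : m * q + M * K ≠ 0) : UnstableMode K q P D Ω m M ↔
      modeDet K q (sParam K q P D Ω / (K : ℝ) ^ 2) m (m * q + M * K) < 0 := by
  refine ⟨fun hun => ?_, unstableMode_of_modeDet_neg hK h m M⟩
  obtain ⟨a, b, cp, cm, dp, dm, ha, hpair⟩ := hun
  by_contra! hd
  rw [modeDet_eq hK h] at hd
  have hr := radius_pos hK h
  have hd' := nonneg_of_mul_nonneg_right hd (by positivity)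
  have hu := (isLinearizedImage_iff hK h hpair.smooth_left).mp hpair.eigen_left 0
  have hv := (isLinearizedImage_iff hK h hpair.smooth_right).mp hpair.eigen_right 0
  simp only [linearized_modePerturbation] at hu hv
  simp only [modePerturbation_eq, singleWave, mul_zero, chi_zero, mul_one] at hu hv
  obtain ⟨u1, u2⟩ := wave_linearIndependent h.1.ne' hn
    (fun z => by linear_combination (hu z)) (q := q) (K := K)
    (X := waveEigenvalue K P D Ω (q + (m * q + M * K)) * cp
      + (coupling K m : ℂ) / (2 * (radius K q P D Ω : ℂ) ^ 2) * conj cm - (a * cp - b * dp))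
    (Y := waveEigenvalue K P D Ω (q - (m * q + M * K)) * cm
      + (coupling K m : ℂ) / (2 * (radius K q P D Ω : ℂ) ^ 2) * conj cp - (a * cm - b * dm))
  obtain ⟨v1, v2⟩ := wave_linearIndependent h.1.ne' hn
    (fun z => by linear_combination (hv z)) (q := q) (K := K)
    (X := waveEigenvalue K P D Ω (q + (m * q + M * K)) * dp
      + (coupling K m : ℂ) / (2 * (radius K q P D Ω : ℂ) ^ 2) * conj dm - (b * cp + a * dp))
    (Y := waveEigenvalue K P D Ω (q - (m * q + M * K)) * dm
      + (coupling K m : ℂ) / (2 * (radius K q P D Ω : ℂ) ^ 2) * conj dp - (b * cm + a * dm))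
  have c2 := congrArg conj u2
  have c4 := congrArg conj v2
  simp only [map_add, map_sub, map_mul, conj_conj, conj_ofReal, map_div₀, map_pow, map_intCast,
    map_ofNat, map_zero] at c2 c4
  refine ha.not_ge (eigenvalue_nonpos (mode_trace_nonpos hK h (m * q + M * K)) (sub_nonneg.mp hd')
    (b := b) (x := cp) (y := conj cm) (x' := dp) (y' := conj dm) ?_ ?_ ?_ ?_ fun hz => ?_)
  · push_cast; exact sub_eq_zero.mp u1
  · push_cast; exact sub_eq_zero.mp c2
  · push_cast; exact sub_eq_zero.mp v1
  · push_cast; exact sub_eq_zero.mp c4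
  · obtain ⟨z1, z2, z3, z4⟩ := hz
    rw [map_eq_zero] at z2 z4
    subst z1 z2 z3 z4
    have hzero : modePerturbation (K := K) q P m M 0 0 = 0 := by
      funext k z; simp [modePerturbation]
    rcases hpair.ne_zero with h0 | h0 <;> exact h0 hzero

end Criterion

/-! ### The sign of the mode determinants -/

section ModeDet

lemma modeDet_expand (K : ℕ) (q : ℤ) (t : ℝ) (m n : ℤ) :
    modeDet K q t m n = ((K : ℝ) - 1) ^ 2 - (coupling K m : ℝ) ^ 2 + 2 * ((K : ℝ) - 1) * t * n ^ 2
      + t ^ 2 * n ^ 2 * ((n : ℝ) ^ 2 - 4 * q ^ 2) := by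
  rw [modeDet]; ring

lemma modeDet_neg_right (K : ℕ) (q : ℤ) (t : ℝ) (m n : ℤ) :
    modeDet K q t m (-n) = modeDet K q t m n := by
  rw [modeDet_expand, modeDet_expand]; push_cast; ring

lemma modeDet_neg_left (K : ℕ) [NeZero K] (q : ℤ) (t : ℝ) (m n : ℤ) :
    modeDet K q t (-m) n = modeDet K q t m n := by
  rw [modeDet, modeDet, coupling_neg]

lemma coupling_emod (K : ℕ) (m : ℤ) : coupling K (m % K) = coupling K m := by
  rw [coupling, coupling, Int.emod_emod_of_dvd _ dvd_rfl]

lemma modeDet_emod (K : ℕ) (q : ℤ) (t : ℝ) (m n : ℤ) :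
    modeDet K q t (m % K) n = modeDet K q t m n := by
  rw [modeDet, modeDet, coupling_emod]

lemma coupling_of_lt {K : ℕ} {m : ℤ} (h0 : 0 ≤ m) (h1 : m < K) :
    coupling K m = (m - 1) * (K - 1 - m) := by
  rw [coupling, Int.emod_eq_of_lt h0 h1]

/-- Up to the symmetries of the mode determinant, every mode satisfies `0 ≤ m ≤ K / 2`. -/
lemma modeDet_nonneg_of_le_half {K : ℕ} [NeZero K] {q : ℤ} {t : ℝ}
    (h : ∀ m n : ℤ, 0 ≤ m → 2 * m ≤ K → (K : ℤ) ∣ n - m * q → 0 ≤ modeDet K q t m n)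
    (m M : ℤ) : 0 ≤ modeDet K q t m (m * q + M * K) := by
  have hK : (0 : ℤ) < K := by exact_mod_cast NeZero.pos K
  have h1 := Int.emod_nonneg m hK.ne'
  have h2 := Int.emod_lt_of_pos m hK
  have h3 := Int.emod_add_mul_ediv m K
  by_cases hm : 2 * (m % K) ≤ K
  · rw [← modeDet_emod]
    exact h _ _ h1 hm ⟨q * (m / K) + M, by linear_combination -q * h3⟩
  · have h4 : (-(K - m % K)) % K = m % K := by
      rw [show -((K : ℤ) - m % K) = m % K + K * (-1) by ring, Int.add_mul_emod_self_left,
        Int.emod_emod_of_dvd _ dvd_rfl]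
    rw [← modeDet_emod, ← h4, modeDet_emod, modeDet_neg_left, ← modeDet_neg_right]
    exact h _ _ (by omega) (by omega) ⟨-(q * (m / K) + M) - q, by linear_combination q * h3⟩

/-- Up to the symmetries of the mode determinant, every mode satisfies `0 ≤ m < K` and `0 ≤ n`. -/
lemma modeDet_nonneg_of_nonneg {K : ℕ} [NeZero K] {q : ℤ} {t : ℝ}
    (h : ∀ i j : ℕ, i < K → (K : ℤ) ∣ j - i * q → 0 ≤ modeDet K q t i j)
    (m M : ℤ) : 0 ≤ modeDet K q t m (m * q + M * K) := by
  have hK : (0 : ℤ) < K := by exact_mod_cast NeZero.pos K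
  have main (m M : ℤ) (hn : 0 ≤ m * q + M * K) : 0 ≤ modeDet K q t m (m * q + M * K) := by
    have h2 := Int.emod_lt_of_pos m hK
    have h3 := Int.emod_add_mul_ediv m K
    obtain ⟨i, hi⟩ := Int.eq_ofNat_of_zero_le (Int.emod_nonneg m hK.ne')
    obtain ⟨j, hj⟩ := Int.eq_ofNat_of_zero_le hn
    rw [← modeDet_emod, hi, hj]
    refine h i j (by omega) ⟨q * (m / K) + M, ?_⟩
    rw [← hj, ← hi]
    linear_combination -q * h3
  rcases le_total 0 (m * q + M * K) with hn | hn
  · exact main m M hn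
  · have := main (-m) (-M) (by linarith)
    rwa [show -m * q + -M * K = -(m * q + M * K) by ring, modeDet_neg_right,
      modeDet_neg_left] at this

lemma modeDet_one_self {K : ℕ} (hK : 2 ≤ K) (q : ℤ) (t : ℝ) :
    modeDet K q t 1 q = ((K : ℝ) - 1 + 3 * (t * q ^ 2)) * ((K : ℝ) - 1 - t * q ^ 2) := by
  rw [modeDet, coupling_of_lt zero_le_one (by omega)]
  push_cast
  ring

lemma modeDet_zero {K : ℕ} (hK : 0 < K) (q : ℤ) (t : ℝ) (n : ℤ) :
    modeDet K q t 0 n = t * n ^ 2 * (2 * ((K : ℝ) - 1) + t * ((n : ℝ) ^ 2 - 4 * q ^ 2)) := by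
  rw [modeDet_expand, coupling_of_lt le_rfl (by omega)]
  push_cast
  ring

/-- Every term of the expansion is nonnegative; this reduces the table to finitely many modes. -/
lemma modeDet_nonneg_of_two_mul_le {K : ℕ} (hK : 1 ≤ K) {q : ℤ} {t : ℝ} (ht : 0 ≤ t) {m n : ℤ}
    (hγ : (coupling K m) ^ 2 ≤ ((K : ℤ) - 1) ^ 2) (hn : 4 * q ^ 2 ≤ n ^ 2) :
    0 ≤ modeDet K q t m n := by
  have h1 : (coupling K m : ℝ) ^ 2 ≤ ((K : ℝ) - 1) ^ 2 := by exact_mod_cast hγ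
  have h2 : 4 * (q : ℝ) ^ 2 ≤ (n : ℝ) ^ 2 := by exact_mod_cast hn
  have h3 : (0 : ℝ) ≤ (K : ℝ) - 1 := sub_nonneg.mpr (by exact_mod_cast hK)
  rw [modeDet_expand]
  have h4 : 0 ≤ 2 * ((K : ℝ) - 1) * t * n ^ 2 := by positivity
  have h5 : 0 ≤ t ^ 2 * n ^ 2 * ((n : ℝ) ^ 2 - 4 * q ^ 2) :=
    mul_nonneg (by positivity) (by linarith)
  linarith

end ModeDet

/-! ### At most seven filaments -/

section FewFilaments

variable {K : ℕ} [NeZero K]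

/-- This is where seven comes from: for `K = 7` the maximum `K - 1 = 6` is attained at `m = 3, 4`,
and for `K = 8` the value at `m = 4` is `9 > 7`. -/
lemma coupling_sq_le (hK7 : K ≤ 7) (m : ℤ) : (coupling K m) ^ 2 ≤ ((K : ℤ) - 1) ^ 2 := by
  have hK : (0 : ℤ) < K := by exact_mod_cast NeZero.pos K
  have h1 := Int.emod_nonneg m hK.ne'
  have h2 := Int.emod_lt_of_pos m hK
  rw [coupling]
  generalize m % K = i at *
  have h3 : -((K : ℤ) - 1) ≤ (i - 1) * (K - 1 - i) := by nlinarith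
  have h4 : (i - 1) * (K - 1 - i) ≤ (K : ℤ) - 1 := by
    have : i ≤ 6 := by omega
    interval_cases i <;> omega
  nlinarith

/-- For `t > 0`, dividing by `t²` gives a nonincreasing function of `t`, as the constant and linear
coefficients are nonnegative. -/
lemma modeDet_nonneg_of_le {q : ℤ} (hK7 : K ≤ 7) {t t' : ℝ} (ht' : 0 ≤ t') (htt' : t' ≤ t)
    {m n : ℤ} (h : 0 ≤ modeDet K q t m n) : 0 ≤ modeDet K q t' m n := by
  have h1 : (coupling K m : ℝ) ^ 2 ≤ ((K : ℝ) - 1) ^ 2 := by exact_mod_cast coupling_sq_le hK7 m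
  have h3 : (0 : ℝ) ≤ (K : ℝ) - 1 := sub_nonneg.mpr (by exact_mod_cast NeZero.one_le)
  rcases ht'.eq_or_lt with h0 | h0
  · rw [modeDet_expand, ← h0]; simpa using h1
  have ht : 0 < t := h0.trans_le htt'
  have h4 : 0 ≤ t' ^ 2 * modeDet K q t m n := by positivity
  refine nonneg_of_mul_nonneg_right (a := t ^ 2) ?_ (by positivity)
  rw [modeDet_expand] at h4 ⊢
  have h5 : t' ^ 2 ≤ t ^ 2 := by gcongr
  have h6 : 0 ≤ (t ^ 2 - t' ^ 2) * (((K : ℝ) - 1) ^ 2 - (coupling K m : ℝ) ^ 2) :=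
    mul_nonneg (by linarith) (by linarith)
  have h7 : 0 ≤ 2 * ((K : ℝ) - 1) * n ^ 2 * (t * t' * (t - t')) := by
    have : 0 ≤ t - t' := by linarith
    positivity
  linarith

lemma exists_threshold (hK : 2 ≤ K) (hK7 : K ≤ 7) {q : ℤ} (hq : 0 < q) :
    ∃ T : ℝ, 0 < T ∧ ∀ t : ℝ, 0 < t →
      ((∀ m M : ℤ, 0 ≤ modeDet K q t m (m * q + M * K)) ↔ t ≤ T) := by
  have hK' : (2 : ℝ) ≤ K := by exact_mod_cast hK
  have hq' : (0 : ℝ) < q := by exact_mod_cast hq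
  set S : Set ℝ := {t | 0 ≤ t ∧ ∀ m M : ℤ, 0 ≤ modeDet K q t m (m * q + M * K)} with hS
  have hclosed : IsClosed S := by
    have : S = Set.Ici 0 ∩ ⋂ m : ℤ, ⋂ M : ℤ, {t | 0 ≤ modeDet K q t m (m * q + M * K)} := by
      ext t; simp [hS]
    rw [this]
    refine isClosed_Ici.inter (isClosed_iInter fun m => isClosed_iInter fun M =>
      isClosed_le continuous_const ?_)
    simp only [modeDet_expand]
    fun_prop
  have hbdd : BddAbove S := by
    -- The bound imposed by mode `(1,0)`.
    refine ⟨((K : ℝ) - 1) / q ^ 2, fun t ht => ?_⟩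
    have h1 := ht.2 1 0
    rw [one_mul, zero_mul, add_zero, modeDet_one_self hK] at h1
    have ht0 := ht.1
    have h2 := nonneg_of_mul_nonneg_right h1 (by have : 0 ≤ t * (q : ℝ) ^ 2 := by positivity
                                                 linarith)
    rw [le_div_iff₀ (by positivity)]
    linarith
  -- At this `t` the linear term cancels `-4q² t² n²`, leaving `t² n⁴`.
  have hmem : ((K : ℝ) - 1) / (2 * q ^ 2) ∈ S := by
    have h0 : 0 ≤ ((K : ℝ) - 1) / (2 * q ^ 2) := div_nonneg (by linarith) (by positivity)
    refine ⟨h0, fun m M => ?_⟩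
    generalize m * q + M * K = n
    have h1 : (coupling K m : ℝ) ^ 2 ≤ ((K : ℝ) - 1) ^ 2 := by exact_mod_cast coupling_sq_le hK7 m
    rw [modeDet_expand]
    have h2 : 2 * ((K : ℝ) - 1) * (((K : ℝ) - 1) / (2 * q ^ 2)) * n ^ 2
      + (((K : ℝ) - 1) / (2 * q ^ 2)) ^ 2 * n ^ 2 * ((n : ℝ) ^ 2 - 4 * q ^ 2)
      = (((K : ℝ) - 1) / (2 * q ^ 2)) ^ 2 * (n ^ 2) ^ 2 := by
      field_simp
      ring
    have h3 : 0 ≤ (((K : ℝ) - 1) / (2 * q ^ 2)) ^ 2 * ((n : ℝ) ^ 2) ^ 2 := by positivity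
    linarith
  have hT := hclosed.csSup_mem ⟨_, hmem⟩ hbdd
  refine ⟨sSup S, lt_of_lt_of_le (div_pos (by linarith) (by positivity)) (le_csSup hbdd hmem),
    fun t ht => ⟨fun h => le_csSup hbdd ⟨ht.le, h⟩, fun h m M =>
      modeDet_nonneg_of_le hK7 ht.le h (hT.2 m M)⟩⟩

/-- The mode determinant at `s = S / (2 · 10⁸)`, times `(2 · 10⁸ K²)²`. -/
def intModeDet (K q S i j : ℤ) : ℤ :=
  (200000000 * K ^ 2 * (K - 1) + S * (j ^ 2 + 2 * q * j)) *
      (200000000 * K ^ 2 * (K - 1) + S * (j ^ 2 - 2 * q * j))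
    - (200000000 * K ^ 2 * ((i - 1) * (K - 1 - i))) ^ 2

lemma intModeDet_eq (q S : ℤ) {i : ℕ} (hi : i < K) (j : ℕ) :
    (intModeDet K q S i j : ℝ) = (200000000 * (K : ℝ) ^ 2) ^ 2 *
      modeDet K q ((S : ℝ) / 200000000 / (K : ℝ) ^ 2) i j := by
  have hK : (K : ℝ) ≠ 0 := Nat.cast_ne_zero.mpr (NeZero.ne K)
  rw [modeDet, coupling_of_lt (by omega) (by omega), intModeDet]
  push_cast
  field_simp

/-- `sMaxTable`, times `10⁵`. -/
def intTable : Matrix (Fin 6) (Fin 6) ℤ :=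
  !![400000, 66670, 25000, 13330, 8333, 5714;
     1800000, 450000, 133300, 65450, 39560, 26670;
     4800000, 1200000, 480000, 200000, 114300, 75000;
     10000000, 2500000, 1111000, 512800, 266700, 168100;
     18000000, 4063000, 1628000, 1016000, 562500, 333300;
     29400000, 3920000, 1838000, 980000, 593900, 435600]

lemma sMaxTable_eq (i j : Fin 6) : sMaxTable i j = (intTable i j : ℝ) / 100000 := by
  fin_cases i <;> fin_cases j <;> norm_num [sMaxTable, intTable]

/-- The factor `1999` puts `s` at `1 - 5·10⁻⁴` times the table entry, and `2001` in the next lemma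
at `1 + 5·10⁻⁴` times it. -/
lemma intModeDet_table_nonneg : ∀ a b : Fin 6, ∀ i < a.val + 2, ∀ j < 2 * (b.val + 1),
    ((j : ℤ) - i * (b.val + 1 : ℕ)) % (a.val + 2 : ℕ) = 0 →
      0 ≤ intModeDet (a.val + 2 : ℕ) (b.val + 1 : ℕ) (1999 * intTable a b) i j := by
  decide +kernel

lemma intModeDet_table_neg : ∀ a b : Fin 6, ∃ i < a.val + 2, ∃ j < 2 * (b.val + 1),
    ((j : ℤ) - i * (b.val + 1 : ℕ)) % (a.val + 2 : ℕ) = 0 ∧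
      intModeDet (a.val + 2 : ℕ) (b.val + 1 : ℕ) (2001 * intTable a b) i j < 0 := by
  decide +kernel

lemma intTable_pos (a b : Fin 6) : 0 < intTable a b := by
  fin_cases a <;> fin_cases b <;> norm_num [intTable]

lemma table_error_le (hK7 : K ≤ 7) {q : ℤ} {T : ℝ}
    (hT : ∀ t : ℝ, 0 < t → ((∀ m M : ℤ, 0 ≤ modeDet K q t m (m * q + M * K)) ↔ t ≤ T))
    (a b : Fin 6) (ha : K = (a : ℕ) + 2) (hb : q = ((b : ℕ) : ℤ) + 1) :
    |(K : ℝ) ^ 2 * T - sMaxTable a b| ≤ 5 / 10 ^ 4 * sMaxTable a b := by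
  have hK : (0 : ℝ) < K := Nat.cast_pos.mpr (NeZero.pos K)
  have hb' : q = ((b.val + 1 : ℕ) : ℤ) := by rw [hb]; push_cast; rfl
  have hpos : (0 : ℝ) < intTable a b := by exact_mod_cast intTable_pos a b
  have hlo : ((1999 * intTable a b : ℤ) : ℝ) / 200000000 / (K : ℝ) ^ 2 ≤ T := by
    have ht : 0 < ((1999 * intTable a b : ℤ) : ℝ) / 200000000 / (K : ℝ) ^ 2 := by
      push_cast; positivity
    refine (hT _ ht).mp (modeDet_nonneg_of_nonneg fun i j hi hdvd => ?_)
    by_cases hj : j < 2 * (b.val + 1)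
    · have h1 := intModeDet_table_nonneg a b i (ha ▸ hi) j hj
        (by rw [← ha, ← hb']; exact Int.emod_eq_zero_of_dvd hdvd)
      rw [← ha, ← hb'] at h1
      have h2 : (0 : ℝ) ≤ intModeDet K q (1999 * intTable a b) i j := by exact_mod_cast h1
      rw [intModeDet_eq q _ hi] at h2
      exact nonneg_of_mul_nonneg_right h2 (by positivity)
    · refine modeDet_nonneg_of_two_mul_le NeZero.one_le ht.le (coupling_sq_le hK7 _) ?_
      have h3 : 2 * q ≤ j := by omega
      have h4 : 0 ≤ q := by omega
      nlinarith
  have hhi : T ≤ ((2001 * intTable a b : ℤ) : ℝ) / 200000000 / (K : ℝ) ^ 2 := by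
    have ht : 0 < ((2001 * intTable a b : ℤ) : ℝ) / 200000000 / (K : ℝ) ^ 2 := by
      push_cast; positivity
    by_contra! hlt
    obtain ⟨i, hi, j, -, hmod, hneg⟩ := intModeDet_table_neg a b
    rw [← ha, ← hb'] at hneg hmod
    obtain ⟨M, hM⟩ := Int.dvd_of_emod_eq_zero hmod
    have h1 := (hT _ ht).mpr hlt.le i M
    rw [show (i : ℤ) * q + M * K = j by linear_combination -hM] at h1
    have h2 : (intModeDet K q (2001 * intTable a b) i j : ℝ) < 0 := by exact_mod_cast hneg
    rw [intModeDet_eq q _ (ha ▸ hi)] at h2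
    have h3 : 0 ≤ (200000000 * (K : ℝ) ^ 2) ^ 2 := by positivity
    exact absurd (mul_nonneg h3 h1) (not_le.mpr h2)
  rw [div_le_iff₀ (by positivity)] at hlo
  rw [le_div_iff₀ (by positivity)] at hhi
  rw [sMaxTable_eq, abs_le]
  push_cast at hlo hhi
  constructor <;> linarith

end FewFilaments

/-! ### More than seven filaments -/

section ManyFilaments

/-- A mode whose determinant is negative for every `t`. -/
lemma modeDet_neg_of_lt {K : ℕ} {q : ℤ} (t : ℝ) {m n : ℤ} (hn : n ^ 2 < 4 * q ^ 2)
    (h : 4 * q ^ 2 * ((K : ℤ) - 1) ^ 2 < (coupling K m) ^ 2 * (4 * q ^ 2 - n ^ 2)) :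
    modeDet K q t m n < 0 := by
  have hn' : (0 : ℝ) < 4 * (q : ℝ) ^ 2 - (n : ℝ) ^ 2 := by
    rw [sub_pos]; exact_mod_cast hn
  have h' : 4 * (q : ℝ) ^ 2 * ((K : ℝ) - 1) ^ 2
      < (coupling K m : ℝ) ^ 2 * (4 * (q : ℝ) ^ 2 - (n : ℝ) ^ 2) := by exact_mod_cast h
  refine neg_of_mul_neg_right (a := 4 * (q : ℝ) ^ 2 - (n : ℝ) ^ 2) ?_ hn'.le
  -- Completing the square: `(4q² - n²)` times the determinant is minus this square plus `4q²(K-1)²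
  -- - γ²(4q² - n²)`.
  have h1 : 0 ≤ (n : ℝ) ^ 2 * (t * (4 * (q : ℝ) ^ 2 - (n : ℝ) ^ 2) - ((K : ℝ) - 1)) ^ 2 := by
    positivity
  rw [modeDet_expand]
  linarith

lemma exists_modeDet_neg {K : ℕ} (hK : 7 < K) {q : ℤ} (hq : 0 ≤ q) (hq1 : q ≠ 1) (t : ℝ) :
    ∃ m M : ℤ, modeDet K q t m (m * q + M * K) < 0 := by
  have hK8 : (8 : ℤ) ≤ K := by omega
  have hγ4 : coupling K 4 = 3 * ((K : ℤ) - 5) := by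
    rw [coupling_of_lt (by norm_num) (by omega)]; ring
  rcases hq.eq_or_lt with h0 | h0
  · refine ⟨4, 0, ?_⟩
    rw [modeDet_expand, hγ4, ← h0]
    have : (8 : ℝ) ≤ K := by exact_mod_cast hK8
    push_cast
    nlinarith
  have hq2 : 2 ≤ q := by omega
  by_cases hcase : 2 * (K : ℤ) ≤ 5 * q
  -- For `q ≥ 2K/5` take `m = 4` and `-M` the rounding of `4q/K`, so that `|n| ≤ K/2 ≤ 5q/4`.
  · have hdm := Int.emod_add_mul_ediv (8 * q + K) (2 * K)
    have h1 := Int.emod_nonneg (8 * q + K) (b := 2 * (K : ℤ)) (by omega)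
    have h2 := Int.emod_lt_of_pos (8 * q + K) (b := 2 * (K : ℤ)) (by omega)
    refine ⟨4, -((8 * q + K) / (2 * K)), ?_⟩
    generalize (8 * q + K) / (2 * K) = M at *
    obtain ⟨n, hn⟩ : ∃ n, n = 4 * q + -M * K := ⟨_, rfl⟩
    rw [← hn]
    have hn1 : 2 * n ≤ K := by linarith
    have hn2 : -(K : ℤ) ≤ 2 * n := by linarith
    have hn3 : 4 * n ^ 2 ≤ (K : ℤ) ^ 2 := by nlinarith
    have hq3 : 4 * (K : ℤ) ^ 2 ≤ 25 * q ^ 2 := by nlinarith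
    refine modeDet_neg_of_lt t (by nlinarith) ?_
    rw [hγ4]
    -- Tight at `K = 8`: `12544 < 12636`.
    have h3 : 16 * ((K : ℤ) - 1) ^ 2 * 16 < 9 * ((K : ℤ) - 5) ^ 2 * (256 - 100) := by nlinarith
    have h4 : 0 < q ^ 2 := by positivity
    have h5 : 16 * n ^ 2 ≤ 25 * q ^ 2 := by linarith
    have h6 : 0 ≤ (3 * ((K : ℤ) - 5)) ^ 2 * (25 * q ^ 2 - 16 * n ^ 2) :=
      mul_nonneg (sq_nonneg _) (by linarith)
    nlinarith
  -- For `2 ≤ q < 2K/5` take `M = -1` and `m` the rounding of `K/q`: then `|n| ≤ q/2`, and `3 ≤ m ≤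
  -- K - 3` gives `γ ≥ 2(K - 4)`.
  · have hdm := Int.emod_add_mul_ediv (2 * K + q) (2 * q)
    have h1 := Int.emod_nonneg (2 * K + q) (b := 2 * q) (by omega)
    have h2 := Int.emod_lt_of_pos (2 * K + q) (b := 2 * q) (by omega)
    refine ⟨(2 * K + q) / (2 * q), -1, ?_⟩
    generalize (2 * K + q) / (2 * q) = m at *
    have hm3 : 3 ≤ m := by
      by_contra! hlt
      nlinarith
    have hmK : m ≤ K - 3 := by
      by_contra! hlt
      nlinarith
    obtain ⟨n, hn⟩ : ∃ n, n = m * q + -1 * K := ⟨_, rfl⟩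
    rw [← hn]
    have hn1 : 2 * n ≤ q := by linarith
    have hn2 : -q ≤ 2 * n := by linarith
    have hn3 : 4 * n ^ 2 ≤ q ^ 2 := by nlinarith
    have hγ : 2 * ((K : ℤ) - 4) ≤ coupling K m := by
      rw [coupling_of_lt (by omega) (by omega)]
      nlinarith [mul_nonneg (sub_nonneg.mpr hm3) (sub_nonneg.mpr hmK)]
    have hγ2 : 4 * ((K : ℤ) - 4) ^ 2 ≤ (coupling K m) ^ 2 := by nlinarith
    have hq0 : 0 < q ^ 2 := by positivity
    refine modeDet_neg_of_lt t (by linarith) ?_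
    have h3 : 4 * ((K : ℤ) - 1) ^ 2 < 15 * ((K : ℤ) - 4) ^ 2 := by nlinarith
    have h4 : 4 * ((K : ℤ) - 4) ^ 2 * (15 * q ^ 2)
        ≤ (coupling K m) ^ 2 * (4 * (4 * q ^ 2 - n ^ 2)) :=
      mul_le_mul hγ2 (by linarith) (by positivity) (sq_nonneg _)
    have h5 := mul_lt_mul_of_pos_right h3 hq0
    linarith

/-- For `q = 1` the mode `(4,0)` is the last of the modes `(m,0)`, `m ≥ 2`, to become stable. -/
lemma modeDet_self_nonneg {K : ℕ} (hK : 7 < K) {t : ℝ} (ht : 0 < t)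
    (h4 : 0 ≤ modeDet K 1 t 4 4) {j : ℤ} (hj2 : 2 ≤ j) (hjK : 2 * j ≤ K) :
    0 ≤ modeDet K 1 t j j := by
  have hK8 : (8 : ℝ) ≤ K := by exact_mod_cast hK
  have hform (j : ℤ) (h2 : 2 ≤ j) (hj : j < K) : modeDet K 1 t j j =
      j * (((K : ℝ) - j) * (2 * (K - 1) - j * (K - j)) + 2 * (K - 1) * j * t
        + j * (j ^ 2 - 4) * t ^ 2) := by
    rw [modeDet_expand, coupling_of_lt (by omega) hj]
    push_cast
    ring
  rw [hform 4 (by norm_num) (by omega)] at h4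
  push_cast at h4
  have h4' : 0 ≤ ((K : ℝ) - 4) * (7 - K) + 4 * (K - 1) * t + 24 * t ^ 2 := by linarith
  -- At `t = (K-7)/8` the quadratic in `h4'` equals `-(K-7)²/8 < 0`. This lower bound on `t` drives
  -- the other cases.
  have htK : ((K : ℝ) - 7) / 8 < t := by
    by_contra! hle
    have h5 : t ^ 2 ≤ t * (((K : ℝ) - 7) / 8) := by nlinarith
    nlinarith
  rw [hform j hj2 (by omega)]
  have hj0 : (0 : ℝ) ≤ j := by exact_mod_cast (by omega : (0 : ℤ) ≤ j)
  refine mul_nonneg hj0 ?_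
  have hcases : j = 2 ∨ j = 3 ∨ j = 4 ∨ j = 5 ∨ 6 ≤ j := by omega
  rcases hcases with rfl | rfl | rfl | rfl | hj6
  · push_cast
    have : 0 ≤ ((K : ℝ) - 1) * t := mul_nonneg (by linarith) ht.le
    nlinarith
  · push_cast
    by_contra! hlt
    have h6 : ((K : ℝ) - 1) * (((K : ℝ) - 7) / 8) ≤ ((K : ℝ) - 1) * t :=
      mul_le_mul_of_nonneg_left htK.le (by linarith)
    nlinarith
  · push_cast; linarith
  · push_cast
    by_contra! hlt
    have hK10 : (10 : ℝ) ≤ K := by exact_mod_cast hjK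
    -- The assumed inequality for `j = 5` minus three times `h4'`. Its discriminant is negative for
    -- `10 ≤ K ≤ 100`; for larger `K` it forces `33t < 2(K-1)`, against `htK`.
    have h7 : 33 * t ^ 2 - 2 * ((K : ℝ) - 1) * t + 5 * K - 31 < 0 := by linarith
    rcases le_total (K : ℝ) 100 with h8 | h8
    · nlinarith [sq_nonneg (33 * t - (K - 1))]
    · nlinarith
  · have hj6' : (6 : ℝ) ≤ j := by exact_mod_cast hj6
    have hjK' : 2 * (j : ℝ) ≤ K := by exact_mod_cast hjK
    have h9 : 0 ≤ ((K : ℝ) - j) * (2 * (K - 1) - j * (K - j))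
        + 2 * (K - 1) * j * (((K : ℝ) - 7) / 8) + j * (j ^ 2 - 4) * (((K : ℝ) - 7) / 8) ^ 2 := by
      -- In the slacks of `6 ≤ j` and `2j ≤ K` the polynomial has only nonnegative coefficients.
      obtain ⟨a, ha⟩ : ∃ a : ℝ, (j : ℝ) = 6 + a := ⟨j - 6, by ring⟩
      obtain ⟨b, hb⟩ : ∃ b : ℝ, (K : ℝ) = 2 * (6 + a) + b := ⟨K - 2 * (6 + a), by ring⟩
      have ha0 : 0 ≤ a := by linarith
      have hb0 : 0 ≤ b := by linarith
      rw [hb, ha]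
      ring_nf
      positivity
    have h10 : 2 * ((K : ℝ) - 1) * j * (((K : ℝ) - 7) / 8) ≤ 2 * ((K : ℝ) - 1) * j * t :=
      mul_le_mul_of_nonneg_left htK.le (mul_nonneg (by linarith) hj0)
    have h11 : (j : ℝ) * (j ^ 2 - 4) * (((K : ℝ) - 7) / 8) ^ 2 ≤ j * (j ^ 2 - 4) * t ^ 2 := by
      have : (0 : ℝ) ≤ (K - 7) / 8 := by linarith
      have h12 : (0 : ℝ) ≤ (j : ℝ) ^ 2 - 4 := by nlinarith
      gcongr
    linarith

lemma modeDet_nonneg_of_four {K : ℕ} [NeZero K] (hK : 7 < K) {t : ℝ} (ht : 0 < t)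
    (h4 : 0 ≤ modeDet K 1 t 4 4) (ht1 : t ≤ (K : ℝ) - 1) (m M : ℤ) :
    0 ≤ modeDet K 1 t m (m * 1 + M * K) := by
  refine modeDet_nonneg_of_le_half (fun j n hj0 hjK hdvd => ?_) m M
  have hK8 : (8 : ℝ) ≤ K := by exact_mod_cast hK
  obtain ⟨M, hM⟩ := hdvd
  have hn : n = j + K * M := by linarith
  -- As `0 ≤ 2j ≤ K`, `j` has least absolute value in its class mod `K`.
  have hnj : j ^ 2 ≤ n ^ 2 := by
    rcases lt_trichotomy M 0 with h | h | h
    · have : n ≤ -j := by nlinarith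
      nlinarith
    · rw [hn, h]; simp
    · have : j ≤ n := by nlinarith
      nlinarith
  have hcases : j = 0 ∨ j = 1 ∨ 2 ≤ j := by omega
  rcases hcases with rfl | rfl | hj2
  · rw [modeDet_zero (by omega)]
    rcases eq_or_ne M 0 with rfl | hM0
    · simp [hn]
    · have h64 : 4 ≤ n ^ 2 := by
        have h1 : 1 ≤ M ^ 2 := by
          have := sq_pos_of_ne_zero hM0
          omega
        have h2 : n ^ 2 = (K : ℤ) ^ 2 * M ^ 2 := by rw [hn]; ring
        have h3 : (8 : ℤ) ≤ K := by omega
        nlinarith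
      have h64' : (4 : ℝ) ≤ (n : ℝ) ^ 2 := by exact_mod_cast h64
      refine mul_nonneg (by positivity) ?_
      have : 0 ≤ t * ((n : ℝ) ^ 2 - 4) := mul_nonneg ht.le (by linarith)
      push_cast
      linarith
  · by_cases hn4 : 4 ≤ n ^ 2
    · refine modeDet_nonneg_of_two_mul_le (by omega) ht.le ?_ (by linarith)
      rw [coupling_of_lt zero_le_one (by omega), sub_self, zero_mul]
      positivity
    · have hn1 : (n : ℝ) ^ 2 = 1 := by
        have h1 : n < 2 := by nlinarith
        have h2 : -2 < n := by nlinarith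
        have h3 : n ≠ 0 := by rintro rfl; norm_num at hnj
        have h4 : n = 1 ∨ n = -1 := by omega
        rcases h4 with rfl | rfl <;> norm_num
      -- Here the determinant is `(K-1+3t)(K-1-t)`, so `ht1` is exactly what is needed.
      rw [modeDet_expand, coupling_of_lt zero_le_one (by omega), hn1]
      push_cast
      nlinarith
  · have hself := modeDet_self_nonneg hK ht h4 hj2 hjK
    rw [modeDet_expand] at hself ⊢
    have hnj' : (j : ℝ) ^ 2 ≤ (n : ℝ) ^ 2 := by exact_mod_cast hnj
    have hj4 : (4 : ℝ) ≤ (j : ℝ) ^ 2 := by exact_mod_cast (by nlinarith : (4 : ℤ) ≤ j ^ 2)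
    -- For `n² ≥ j² ≥ 4` the determinant increases with `n²`, so `n = j` is the worst case.
    have h1 : 0 ≤ 2 * ((K : ℝ) - 1) * t * ((n : ℝ) ^ 2 - j ^ 2) :=
      mul_nonneg (mul_nonneg (by linarith) ht.le) (by linarith)
    have h2 : 0 ≤ t ^ 2 * (((n : ℝ) ^ 2 - j ^ 2) * ((n : ℝ) ^ 2 + j ^ 2 - 4)) :=
      mul_nonneg (sq_nonneg t) (mul_nonneg (by linarith) (by linarith))
    push_cast at hself ⊢
    linarith

end ManyFilaments

/-! ### The thresholds in terms of `s` -/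

section Thresholds

lemma mul_neg_iff_of_pos {a b : ℝ} (ha : 0 < a) : a * b < 0 ↔ b < 0 :=
  ⟨fun h => neg_of_mul_neg_right h ha.le, mul_neg_of_pos_of_neg ha⟩

variable {K : ℕ} [NeZero K] {q : ℤ} {P D Ω : ℝ}

/-- The left side is `2r²Dω²`; comparing it with `K - 1` therefore reads off the sign of `Ω`. -/
lemma sParam_mul_sq (h : Admissible K q P D Ω) :
    sParam K q P D Ω / (K : ℝ) ^ 2 * (q : ℝ) ^ 2
      = (K : ℝ) - 1 - 2 * radius K q P D Ω ^ 2 * Ω := by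
  have hK : (K : ℝ) ≠ 0 := Nat.cast_ne_zero.mpr (NeZero.ne K)
  have hP := h.1.ne'
  rw [← radius_sq h, sParam]
  simp only [waveNumber]
  field_simp
  ring

lemma sOneZero_lt_iff (hq : 0 < q) {s : ℝ} :
    sOneZero K q < s ↔ (K : ℝ) - 1 < s / (K : ℝ) ^ 2 * (q : ℝ) ^ 2 := by
  have hK : (0 : ℝ) < K := Nat.cast_pos.mpr (NeZero.pos K)
  have hq' : (0 : ℝ) < q := by exact_mod_cast hq
  rw [sOneZero, div_lt_iff₀ (by positivity), div_mul_eq_mul_div, lt_div_iff₀ (by positivity)]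

lemma eq_sOneZero_iff (hq : 0 < q) {s : ℝ} :
    s = sOneZero K q ↔ s / (K : ℝ) ^ 2 * (q : ℝ) ^ 2 = (K : ℝ) - 1 := by
  have hK : (K : ℝ) ≠ 0 := Nat.cast_ne_zero.mpr (NeZero.ne K)
  have hq' : (q : ℝ) ≠ 0 := by exact_mod_cast hq.ne'
  rw [sOneZero, eq_div_iff (by positivity), div_mul_eq_mul_div, div_eq_iff (by positivity)]

lemma unstableMode_one_zero_iff (hK : 2 ≤ K) (hq : 0 < q) (h : Admissible K q P D Ω) :
    UnstableMode K q P D Ω 1 0 ↔ sOneZero K q < sParam K q P D Ω := by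
  have hK' : (2 : ℝ) ≤ K := by exact_mod_cast hK
  have hs := sParam_pos hK h
  have h1 : (1 : ℤ) * q + 0 * K = q := by ring
  rw [unstableMode_iff hK h 1 0 (by rw [h1]; exact hq.ne'), h1, modeDet_one_self hK,
    sOneZero_lt_iff hq, mul_neg_iff_of_pos]
  · exact sub_neg
  · have : 0 ≤ sParam K q P D Ω / (K : ℝ) ^ 2 * (q : ℝ) ^ 2 := by positivity
    linarith

lemma sOneZero_lt_sParam_iff (hK : 2 ≤ K) (hq : 0 < q) (h : Admissible K q P D Ω) :
    sOneZero K q < sParam K q P D Ω ↔ Ω < 0 := by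
  have hr : 0 < 2 * radius K q P D Ω ^ 2 := by have := radius_pos hK h; positivity
  rw [sOneZero_lt_iff hq, sParam_mul_sq h, ← mul_neg_iff_of_pos hr]
  constructor <;> intro <;> linarith

lemma sParam_eq_sOneZero_iff (hK : 2 ≤ K) (hq : 0 < q) (h : Admissible K q P D Ω) :
    sParam K q P D Ω = sOneZero K q ↔ Ω = 0 := by
  have hr : 0 < 2 * radius K q P D Ω ^ 2 := by have := radius_pos hK h; positivity
  rw [eq_sOneZero_iff hq, sParam_mul_sq h, sub_eq_self, mul_eq_zero, or_iff_right hr.ne']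

lemma energeticallyStable_of_winding_zero (hK : 2 ≤ K) (hK7 : K ≤ 7)
    (h : Admissible K 0 P D Ω) : EnergeticallyStable K 0 P D Ω := by
  have hs := sParam_pos hK h
  refine energeticallyStable_of_modeDet_nonneg hK h fun m M =>
    modeDet_nonneg_of_two_mul_le (by omega) (by positivity) (coupling_sq_le hK7 m) ?_
  simpa using sq_nonneg (M * (K : ℤ))

lemma sZeroOne_lt_sOneZero_iff {K : ℕ} (hK : 2 ≤ K) (hq : (K : ℝ) / 2 < q) :
    sZeroOne K q < sOneZero K q ↔ (K : ℝ) / Real.sqrt 2 < q := by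
  have hK' : (2 : ℝ) ≤ K := by exact_mod_cast hK
  have hq0 : (0 : ℝ) < q := by linarith
  have hden : 0 < 4 * (q : ℝ) ^ 2 - (K : ℝ) ^ 2 := by nlinarith
  have hc : 0 < ((K : ℝ) - 1) * (K : ℝ) ^ 2 := mul_pos (by linarith) (by positivity)
  have h2 : (K : ℝ) / Real.sqrt 2 < q ↔ (K : ℝ) ^ 2 < 2 * q ^ 2 := by
    rw [← abs_of_pos hq0, ← abs_of_nonneg (by positivity : 0 ≤ (K : ℝ) / Real.sqrt 2),
      ← sq_lt_sq, div_pow, Real.sq_sqrt zero_le_two, div_lt_iff₀ two_pos, sq_abs, mul_comm]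
  rw [h2, sZeroOne, sOneZero, div_lt_div_iff₀ hden (by positivity), mul_assoc 2, mul_assoc 2,
    mul_left_comm, mul_lt_mul_iff_right₀ hc]
  constructor <;> intro <;> linarith

lemma le_sZeroOne {K : ℕ} (hK : 2 ≤ K) (hq : (K : ℝ) / 2 < q) {T : ℝ} (hT : 0 < T)
    (h : 0 ≤ modeDet K q T 0 K) : (K : ℝ) ^ 2 * T ≤ sZeroOne K q := by
  have hK' : (2 : ℝ) ≤ K := by exact_mod_cast hK
  have hden : 0 < 4 * (q : ℝ) ^ 2 - (K : ℝ) ^ 2 := by nlinarith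
  rw [modeDet_zero (by omega)] at h
  push_cast at h
  have h1 := nonneg_of_mul_nonneg_right h (by positivity)
  rw [sZeroOne, le_div_iff₀ hden]
  have h2 : 0 ≤ (K : ℝ) ^ 2 * (2 * ((K : ℝ) - 1) + T * ((K : ℝ) ^ 2 - 4 * q ^ 2)) := by positivity
  linarith

/-- For `K > 7` the constant term is negative, so the roots have opposite signs. -/
lemma exists_quadFourZero_root {K : ℕ} (hK : 7 < K) : ∃ r : ℝ, 0 < r ∧ quadFourZero K r = 0 ∧
    ∀ s : ℝ, 0 < s → (quadFourZero K s = 0 → s = r) ∧ (quadFourZero K s < 0 ↔ s < r) := by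
  have hK8 : (8 : ℝ) ≤ K := by exact_mod_cast hK
  set B : ℝ := 1 / 6 * (K : ℝ) ^ 2 * ((K : ℝ) - 1) with hB
  set C : ℝ := 1 / 24 * (K : ℝ) ^ 4 * ((K : ℝ) - 4) * ((K : ℝ) - 7) with hC
  have hBpos : 0 < B := mul_pos (by positivity) (by linarith)
  have hCpos : 0 < C := mul_pos (mul_pos (by positivity) (by linarith)) (by linarith)
  have hsq := Real.sq_sqrt (by positivity : 0 ≤ B ^ 2 + 4 * C)
  have hlt : B < Real.sqrt (B ^ 2 + 4 * C) := Real.lt_sqrt_of_sq_lt (by linarith)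
  set d := Real.sqrt (B ^ 2 + 4 * C) with hd
  have hfac (s : ℝ) : quadFourZero K s = (s + (B + d) / 2) * (s - (d - B) / 2) := by
    rw [quadFourZero, ← hB, ← hC]
    linear_combination hsq / 4
  refine ⟨(d - B) / 2, by linarith, by rw [hfac]; ring, fun s hs => ?_⟩
  have hpos : 0 < s + (B + d) / 2 := by linarith
  rw [hfac]
  refine ⟨fun h => sub_eq_zero.mp ((mul_eq_zero.mp h).resolve_left hpos.ne'), ?_⟩
  rw [mul_neg_iff_of_pos hpos, sub_neg]

lemma modeDet_four_four (hK : 7 < K) (s : ℝ) :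
    modeDet K 1 (s / (K : ℝ) ^ 2) 4 4 = 192 / (K : ℝ) ^ 4 * quadFourZero K s := by
  have hK0 : (K : ℝ) ≠ 0 := Nat.cast_ne_zero.mpr (NeZero.ne K)
  rw [modeDet_expand, coupling_of_lt (by norm_num) (by omega), quadFourZero]
  push_cast
  field_simp
  ring

lemma unstableMode_four_zero_iff (hK : 7 < K) (h : Admissible K 1 P D Ω) :
    UnstableMode K 1 P D Ω 4 0 ↔ quadFourZero K (sParam K 1 P D Ω) < 0 := by
  have hK0 : (0 : ℝ) < K := Nat.cast_pos.mpr (NeZero.pos K)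
  have h1 : (4 : ℤ) * 1 + 0 * K = 4 := by ring
  rw [unstableMode_iff (by omega) h 4 0 (by rw [h1]; norm_num), h1, modeDet_four_four hK,
    mul_neg_iff_of_pos (by positivity)]

lemma energeticallyStable_of_quadFourZero_nonneg (hK : 7 < K) (h : Admissible K 1 P D Ω)
    (h4 : 0 ≤ quadFourZero K (sParam K 1 P D Ω)) (h1 : sParam K 1 P D Ω ≤ sOneZero K 1) :
    EnergeticallyStable K 1 P D Ω := by
  have hK0 : (0 : ℝ) < K := Nat.cast_pos.mpr (NeZero.pos K)
  have hs := sParam_pos (by omega) h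
  refine energeticallyStable_of_modeDet_nonneg (by omega) h fun m M =>
    modeDet_nonneg_of_four hK (by positivity) ?_ ?_ m M
  · rw [modeDet_four_four hK]; positivity
  · rw [← not_lt, sOneZero_lt_iff one_pos, not_lt] at h1
    simpa using h1

end Thresholds

end

end FilamentRing

/-! ### Assembly of the stability statements -/

theorem mainTheorem4 (K : ℕ) [NeZero K] (hK : 2 ≤ K) (q : ℤ) (hq : 0 ≤ q) :
    -- the mode `(1,0)` and the rotation rate
    (0 < q → ∀ P D Ω : ℝ, FilamentRing.Admissible K q P D Ω →
      (FilamentRing.UnstableMode K q P D Ω 1 0 ↔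
        FilamentRing.sOneZero K q < FilamentRing.sParam K q P D Ω) ∧
      (FilamentRing.sOneZero K q < FilamentRing.sParam K q P D Ω ↔ Ω < 0) ∧
      (FilamentRing.sParam K q P D Ω = FilamentRing.sOneZero K q ↔ Ω = 0) ∧
      (Ω < 0 → ¬ FilamentRing.EnergeticallyStable K q P D Ω)) ∧
    -- at most seven filaments
    (K ≤ 7 → 0 < q → ∃ smax : ℝ, 0 < smax ∧
      (∀ P D Ω : ℝ, FilamentRing.Admissible K q P D Ω →
        (FilamentRing.EnergeticallyStable K q P D Ω ↔
          0 < FilamentRing.sParam K q P D Ω ∧ FilamentRing.sParam K q P D Ω ≤ smax)) ∧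
      ((K : ℝ) / 2 < (q : ℝ) →
        smax ≤ FilamentRing.sZeroOne K q ∧
        (FilamentRing.sZeroOne K q < FilamentRing.sOneZero K q ↔
          (K : ℝ) / Real.sqrt 2 < (q : ℝ))) ∧
      (∀ i j : Fin 6, K = (i : ℕ) + 2 → q = ((j : ℕ) : ℤ) + 1 →
        |smax - FilamentRing.sMaxTable i j| ≤ 5 / 10 ^ 4 * FilamentRing.sMaxTable i j)) ∧
    (K ≤ 7 → q = 0 → ∀ P D Ω : ℝ, FilamentRing.Admissible K q P D Ω →
      FilamentRing.EnergeticallyStable K q P D Ω) ∧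
    -- more than seven filaments, `q = 1`
    (7 < K → q = 1 → ∃ smin : ℝ, 0 < smin ∧ FilamentRing.quadFourZero K smin = 0 ∧
      (∀ s : ℝ, 0 < s → FilamentRing.quadFourZero K s = 0 → s = smin) ∧
      (∀ P D Ω : ℝ, FilamentRing.Admissible K q P D Ω →
        (FilamentRing.EnergeticallyStable K q P D Ω ↔
          smin ≤ FilamentRing.sParam K q P D Ω ∧
            FilamentRing.sParam K q P D Ω ≤ FilamentRing.sOneZero K q) ∧
        (FilamentRing.UnstableMode K q P D Ω 4 0 ↔
          FilamentRing.sParam K q P D Ω < smin))) ∧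
    -- more than seven filaments, `q ≠ 1`
    (7 < K → q ≠ 1 → ∀ P D Ω : ℝ, FilamentRing.Admissible K q P D Ω →
      ¬ FilamentRing.EnergeticallyStable K q P D Ω) := by

  refine ⟨fun hq0 P D Ω h => ?_, fun hK7 hq0 => ?_, fun hK7 hq0 P D Ω h => ?_,
    fun hK8 hq1 => ?_, fun hK8 hq1 P D Ω h => ?_⟩
  · have h1 := FilamentRing.unstableMode_one_zero_iff hK hq0 h
    have h2 := FilamentRing.sOneZero_lt_sParam_iff hK hq0 h
    exact ⟨h1, h2, FilamentRing.sParam_eq_sOneZero_iff hK hq0 h,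
      fun hΩ => FilamentRing.not_energeticallyStable_of_unstableMode (h1.mpr (h2.mpr hΩ))⟩
  · obtain ⟨T, hT0, hT⟩ := FilamentRing.exists_threshold hK hK7 hq0
    have hKpos : (0 : ℝ) < K := Nat.cast_pos.mpr (NeZero.pos K)
    refine ⟨(K : ℝ) ^ 2 * T, by positivity, fun P D Ω h => ?_, fun hqK => ⟨?_, ?_⟩,
      fun i j hi hj => FilamentRing.table_error_le hK7 hT i j hi hj⟩
    · have hs := FilamentRing.sParam_pos hK h
      rw [FilamentRing.energeticallyStable_iff hK h, hT _ (by positivity),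
        div_le_iff₀' (by positivity), and_iff_right hs]
    · refine FilamentRing.le_sZeroOne hK hqK hT0 ?_
      -- The threshold itself is stable, in particular for mode `(0,1)`, whose axial index is `K`.
      simpa using (hT T hT0).mpr le_rfl 0 1
    · exact FilamentRing.sZeroOne_lt_sOneZero_iff hK hqK
  · subst hq0
    exact FilamentRing.energeticallyStable_of_winding_zero hK hK7 h
  · subst hq1
    obtain ⟨r, hr0, hr, hroot⟩ := FilamentRing.exists_quadFourZero_root hK8
    refine ⟨r, hr0, hr, fun s hs => (hroot s hs).1, fun P D Ω h => ?_⟩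
    have hlt := (hroot _ (FilamentRing.sParam_pos hK h)).2
    have h4 := FilamentRing.unstableMode_four_zero_iff hK8 h
    refine ⟨⟨fun hst => ⟨?_, ?_⟩, fun hs => ?_⟩, h4.trans hlt⟩
    · by_contra! hneg
      exact FilamentRing.not_energeticallyStable_of_unstableMode (h4.mpr (hlt.mpr hneg)) hst
    · by_contra! hneg
      exact FilamentRing.not_energeticallyStable_of_unstableMode
        ((FilamentRing.unstableMode_one_zero_iff hK one_pos h).mpr hneg) hst
    · exact FilamentRing.energeticallyStable_of_quadFourZero_nonneg hK8 h
        (not_lt.mp fun hneg => hs.1.not_gt (hlt.mp hneg)) hs.2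
  · obtain ⟨m, M, hneg⟩ := FilamentRing.exists_modeDet_neg hK8 hq hq1
      (FilamentRing.sParam K q P D Ω / (K : ℝ) ^ 2)
    exact FilamentRing.not_energeticallyStable_of_modeDet_neg hK h m M hneg
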